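/- A *classical spacetime* is a structure $(M,t_{ab},h^{ab},\nabla_a)$ where $M$ is a smooth, connected, four-dimensional (Hausdorff) manifold; $t_{ab}$ is a smooth symmetric covariant tensor field of signature $(1,0,0,0)$; $h^{ab}$ is a smooth symmetric contravariant tensor field of signature $(0,1,1,1)$; $\nabla_a$ is a smooth torsion-free derivative operator; and $h^{ab}t_{bc}=\mathbf 0$, $\nabla_a t_{bc}=\mathbf 0$, $\nabla_a h^{bc}=\mathbf 0$. Indices are raised with $h^{ab}$. The curvature $R^a{}_{bcd}$ of $\nabla_a$ is defined by $R^a{}_{bcd}\,\xi^b=-2\nabla_{[c}\nabla_{d]}\xi^a$, and $R_{bc}=R^a{}_{bca}$, $R^{ab}{}_{cd}=h^{bn}R^a{}_{ncd}$, $R^a{}_b{}^c{}_d=h^{cn}R^a{}_{bnd}$. A *temporal orientation* is a continuous covector field $t_a$ with $t_{ab}=t_at_b$. Relative to it, a *timelike curve* is a smooth curve, defined on an interval with more than one point, that is future-directed and parametrized by its $t_{ab}$-length; that is, its tangent field (four-velocity) $\xi^a$ satisfies $t_{ab}\xi^a\xi^b=1$ and $t_a\xi^a>0$. The action of a derivative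 operator $\nabla'$ relative to $\nabla$ is said to be given by $C^a{}_{bc}$ if $\nabla'_n X^a=\nabla_n X^a-C^a{}_{nr}X^r$ for all vector fields $X^a$. **Theorem.** Let $(M,t_{ab},h^{ab},\nabla_a)$ be a classical spacetime with $\nabla_a$ flat ($R^a{}_{bcd}=\mathbf 0$), and let $\phi,\rho$ be smooth real-valued functions on $M$ satisfying Poisson's equation $\nabla^a\nabla_a\phi=h^{ab}\nabla_b\nabla_a\phi=4\pi\rho$. Then there is a derivative operator $\overset{g}{\nabla}_a$ on $M$ whose action relative to $\nabla_a$ is given by $C^a{}_{bc}=-t_{bc}\nabla^a\phi$, and for it the following hold. (G1) $(M,t_{ab},h^{ab},\overset{g}{\nabla}_a)$ is a classical spacetime. (G2) Let $t_a$ be any temporal orientation. Then for every timelike curve with four-velocity field $\xi^a$, $$\xi^n\overset{g}{\nabla}_n\xi^a=\mathbf 0\iff-\nabla^a\phi=\xi^n\nabla_n\xi^a,$$ both at each single point of the curve and as equations holding all along the curve; and $\overset{g}{\nabla}_a$ is the unique smooth torsion-free derivative operator on $M$ such that, for every timelike curve, the left equation holds all along the curve if and only if the right one does. (G3) The curvature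 $\overset{g}{R}{}^a{}_{bcd}$ of $\overset{g}{\nabla}_a$ satisfies $$\overset{g}{R}_{bc}=4\pi\rho\,t_{bc},\qquad \overset{g}{R}{}^{ab}{}_{cd}=\mathbf 0,\qquad \overset{g}{R}{}^{[a}{}_{(b}{}^{c]}{}_{d)}=\mathbf 0.$$ -/

import Mathlib

open Bundle Set
open scoped Manifold ContDiff

noncomputable section

namespace NewtonCartan

/-- The model space `ℝ⁴`. -/
abbrev E4 : Type := EuclideanSpace ℝ (Fin 4)

/-- The tangent space `M_x` of a four-dimensional manifold (modelled on `ℝ⁴`, without boundary).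
In Mathlib it is a copy of `ℝ⁴`, a vector being identified with its components in the preferred
chart at `x`. -/
abbrev Tan {M : Type*} [TopologicalSpace M] [ChartedSpace E4 M] (x : M) : Type :=
  TangentSpace 𝓘(ℝ, E4) x

/-- The cotangent space at `x`. -/
abbrev Cot {M : Type*} [TopologicalSpace M] [ChartedSpace E4 M] (x : M) : Type :=
  TangentSpace 𝓘(ℝ, E4) x →L[ℝ] ℝ

section Fields

variable {M : Type*} [TopologicalSpace M] [ChartedSpace E4 M] [IsManifold 𝓘(ℝ, E4) ∞ M]

/-! ### Tensor fields and their smoothness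

A covariant field `t_ab` is a family of bilinear forms, `t x u w = t_ab u^a w^b`. A contravariant
field `h^ab` is given by the index-raising maps `h x : Cot x → Tan x`, `σ_b ↦ h^ab σ_b`; so
`h^ab α_a β_b = α (h x β)`. -/

/-- The vector field `X` is differentiable at `x`. -/
def VecDiffAt (X : Π x : M, Tan x) (x : M) : Prop :=
  MDifferentiableAt 𝓘(ℝ, E4) (𝓘(ℝ, E4).prod 𝓘(ℝ, E4))
    (fun y ↦ TotalSpace.mk' E4 (E := fun y : M ↦ TangentSpace 𝓘(ℝ, E4) y) y (X y)) x

/-- The covector field `A` is differentiable at `x`. -/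
def CovecDiffAt (A : Π x : M, Cot x) (x : M) : Prop :=
  MDifferentiableAt 𝓘(ℝ, E4) (𝓘(ℝ, E4).prod 𝓘(ℝ, E4 →L[ℝ] ℝ))
    (fun y ↦ TotalSpace.mk' (E4 →L[ℝ] ℝ)
      (E := fun y : M ↦ TangentSpace 𝓘(ℝ, E4) y →L[ℝ] ℝ) y (A y)) x

/-- The covector field `A` is continuous. -/
def ContinuousCovec (A : Π x : M, Cot x) : Prop :=
  Continuous (fun y ↦ TotalSpace.mk' (E4 →L[ℝ] ℝ)
    (E := fun y : M ↦ TangentSpace 𝓘(ℝ, E4) y →L[ℝ] ℝ) y (A y))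

/-- The covariant field `t_ab` is smooth. -/
def SmoothCovariant (t : Π x : M, Tan x →L[ℝ] Cot x) : Prop :=
  ContMDiff 𝓘(ℝ, E4) (𝓘(ℝ, E4).prod 𝓘(ℝ, E4 →L[ℝ] E4 →L[ℝ] ℝ)) ∞
    (fun y ↦ TotalSpace.mk' (E4 →L[ℝ] E4 →L[ℝ] ℝ)
      (E := fun y : M ↦ TangentSpace 𝓘(ℝ, E4) y →L[ℝ] TangentSpace 𝓘(ℝ, E4) y →L[ℝ] ℝ) y (t y))

/-- The contravariant field `h^ab` is smooth. -/
def SmoothContravariant (h : Π x : M, Cot x →L[ℝ] Tan x) : Prop :=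
  ContMDiff 𝓘(ℝ, E4) (𝓘(ℝ, E4).prod 𝓘(ℝ, (E4 →L[ℝ] ℝ) →L[ℝ] E4)) ∞
    (fun y ↦ TotalSpace.mk' ((E4 →L[ℝ] ℝ) →L[ℝ] E4)
      (E := fun y : M ↦ (TangentSpace 𝓘(ℝ, E4) y →L[ℝ] ℝ) →L[ℝ] TangentSpace 𝓘(ℝ, E4) y) y (h y))

/-- `t_ab` is symmetric of signature `(1, 0, 0, 0)` at `x`. -/
def IsTemporalAt (x : M) (t : Tan x →L[ℝ] Cot x) : Prop :=
  (∀ u w, t u w = t w u) ∧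
  ∃ ξ : Module.Basis (Fin 4) ℝ (Tan x),
    ∀ i j, t (ξ i) (ξ j) = if i = j then (if i = 0 then 1 else 0) else 0

/-- `h^ab` is symmetric of signature `(0, 1, 1, 1)` at `x`. -/
def IsSpatialAt (x : M) (h : Cot x →L[ℝ] Tan x) : Prop :=
  (∀ α β : Cot x, α (h β) = β (h α)) ∧
  ∃ σ : Module.Basis (Fin 4) ℝ (Cot x),
    ∀ i j, (σ i) (h (σ j)) = if i = j then (if i = 0 then 0 else 1) else 0

/-! ### Derivative operators

Mathlib's `CovariantDerivative` on the tangent bundle takes a vector field `X` to the field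
`D X` with `D X x v = v^n ∇_n X^a`. It is defined on arbitrary fields, but constrained only at
points where they are differentiable. -/

/-- A covariant derivative on the tangent bundle. -/
abbrev Conn (M : Type*) [TopologicalSpace M] [ChartedSpace E4 M] [IsManifold 𝓘(ℝ, E4) ∞ M] :=
  CovariantDerivative 𝓘(ℝ, E4) E4 (fun x : M ↦ TangentSpace 𝓘(ℝ, E4) x)

/-- `D` is a (smooth, torsion-free) derivative operator. -/
structure IsDerivativeOperator (D : Conn M) : Prop where
  smooth : D.ContMDiffCovariantDerivative ∞
  torsion_free : D.torsion = 0

/-- Two derivative operators are the same: they agree wherever a field is differentiable. -/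
def SameOperator (D D' : Conn M) : Prop :=
  ∀ (X : Π x : M, Tan x) (x : M), VecDiffAt X x → D X x = D' X x

/-- The differential `∇_a f` of a scalar field. -/
def dScalar (f : M → ℝ) (x : M) : Cot x := mvfderiv 𝓘(ℝ, E4) f x

/-- `v^n ∇_n A_a w^a` for a covector field `A`, the action on covectors being determined by the
Leibniz rule `v(A(W)) = (∇_v A)(W) + A(∇_v W)`; here `W` extends `w` with constant components in
the preferred chart at `x`. -/
def covDerivCovec (D : Conn M) (A : Π x : M, Cot x) (x : M) (v w : Tan x) : ℝ :=
  dScalar (fun y ↦ A y (FiberBundle.extend E4 w y)) x v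
    - A x (D (FiberBundle.extend E4 w) x v)

/-- `∇_n t_ab = 0`. -/
def CompatibleCovariant (D : Conn M) (t : Π x : M, Tan x →L[ℝ] Cot x) : Prop :=
  ∀ (X Y : Π x : M, Tan x) (x : M), VecDiffAt X x → VecDiffAt Y x → ∀ v : Tan x,
    dScalar (fun y ↦ t y (X y) (Y y)) x v - t x (D X x v) (Y x) - t x (X x) (D Y x v) = 0

/-- `∇_n h^ab = 0`. -/
def CompatibleContravariant (D : Conn M) (h : Π x : M, Cot x →L[ℝ] Tan x) : Prop :=
  ∀ (A B : Π x : M, Cot x) (x : M), CovecDiffAt A x → CovecDiffAt B x → ∀ v : Tan x,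
    dScalar (fun y ↦ (A y) (h y (B y))) x v
      - covDerivCovec D A x v (h x (B x)) - covDerivCovec D B x v (h x (A x)) = 0

/-- `(M, t_ab, h^ab, ∇_a)` is a classical spacetime (the conditions on `M` itself being carried by
its type class instances). -/
structure IsClassicalSpacetime (t : Π x : M, Tan x →L[ℝ] Cot x)
    (h : Π x : M, Cot x →L[ℝ] Tan x) (D : Conn M) : Prop where
  t_smooth : SmoothCovariant t
  t_signature : ∀ x, IsTemporalAt x (t x)
  h_smooth : SmoothContravariant h
  h_signature : ∀ x, IsSpatialAt x (h x)
  derivative_operator : IsDerivativeOperator D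
  /-- `h^ab t_bc = 0` -/
  orthogonal : ∀ (x : M) (α : Cot x) (w : Tan x), t x (h x α) w = 0
  t_compatible : CompatibleCovariant D t
  h_compatible : CompatibleContravariant D h

/-! ### Curvature -/

/-- The curvature operator `∇_X ∇_Y Z - ∇_Y ∇_X Z - ∇_[X,Y] Z` on vector fields. -/
def curvatureOp (D : Conn M) (X Y Z : Π x : M, Tan x) (x : M) : Tan x :=
  D (fun y ↦ D Z y (Y y)) x (X x) - D (fun y ↦ D Z y (X y)) x (Y x)
    - D Z x (VectorField.mlieBracket 𝓘(ℝ, E4) X Y x)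

/-- The Riemann tensor `R^a_bcd u^b v^c w^d`, with the sign convention
`R^a_bcd Z^b = - 2 ∇_[c ∇_d] Z^a`. The vectors are extended with constant components in the
preferred chart at `x`. -/
def riemann (D : Conn M) (x : M) (u v w : Tan x) : Tan x :=
  -curvatureOp D (FiberBundle.extend E4 v) (FiberBundle.extend E4 w) (FiberBundle.extend E4 u) x

/-- `R^a_bcd = 0`. -/
def IsFlat (D : Conn M) : Prop := ∀ (x : M) (u v w : Tan x), riemann D x u v w = 0

/-- The basis of `M_x` given by the preferred chart at `x`. -/
def frame (x : M) (i : Fin 4) : Tan x := (EuclideanSpace.single i (1 : ℝ) : E4)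

/-- The dual basis. -/
def coframe (x : M) (i : Fin 4) : Cot x := (EuclideanSpace.proj i : E4 →L[ℝ] ℝ)

/-- The Ricci tensor `R_bc u^b v^c`, where `R_bc = R^a_bca`. -/
def ricci (D : Conn M) (x : M) (u v : Tan x) : ℝ :=
  ∑ i, coframe x i (riemann D x u v (frame x i))

/-- `R^ab_cd v^c w^d α_a β_b`, where `R^ab_cd = h^bn R^a_ncd`. -/
def riemannUpUp (h : Π x : M, Cot x →L[ℝ] Tan x) (D : Conn M) (x : M) (α β : Cot x)
    (v w : Tan x) : ℝ :=
  α (riemann D x (h x β) v w)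

/-- `R^a_b^c_d α_a u^b κ_c w^d`, where `R^a_b^c_d = h^cn R^a_bnd`. -/
def riemannMixed (h : Π x : M, Cot x →L[ℝ] Tan x) (D : Conn M) (x : M) (α : Cot x) (u : Tan x)
    (κ : Cot x) (w : Tan x) : ℝ :=
  α (riemann D x u (h x κ) w)

/-- `R^[a_(b^c]_d) α_a u^b κ_c w^d`: antisymmetrized in `a, c` and symmetrized in `b, d`. -/
def riemannMixedSym (h : Π x : M, Cot x →L[ℝ] Tan x) (D : Conn M) (x : M) (α : Cot x) (u : Tan x)
    (κ : Cot x) (w : Tan x) : ℝ :=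
  (1 / 4 : ℝ) * (riemannMixed h D x α u κ w - riemannMixed h D x κ u α w
    + riemannMixed h D x α w κ u - riemannMixed h D x κ w α u)

/-! ### The potential -/

/-- `∇^a φ = h^ab ∇_b φ`. -/
def spatialGradient (h : Π x : M, Cot x →L[ℝ] Tan x) (φ : M → ℝ) (x : M) : Tan x :=
  h x (dScalar φ x)

/-- `∇^a ∇_a φ = h^ab ∇_b ∇_a φ`. -/
def laplacian (h : Π x : M, Cot x →L[ℝ] Tan x) (D : Conn M) (φ : M → ℝ) (x : M) : ℝ :=
  ∑ i, covDerivCovec D (dScalar φ) x (h x (coframe x i)) (frame x i)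

/-- The tensor `C^a_bc = - t_bc ∇^a φ`, as `C x v w = C^a_bc v^b w^c`. -/
def geomTensor (t : Π x : M, Tan x →L[ℝ] Cot x) (h : Π x : M, Cot x →L[ℝ] Tan x)
    (φ : M → ℝ) (x : M) (v w : Tan x) : Tan x :=
  -(t x v w • spatialGradient h φ x)

/-- The action of `D'` relative to that of `D` is given by `C^a_bc`, i.e.
`∇'_n X^a = ∇_n X^a - C^a_nr X^r`. (The action on scalars is common to all derivative operators,
and the action on vector fields fixes the action on all other tensor fields.) -/
def RelativeAction (D : Conn M) (C : Π x : M, Tan x → Tan x → Tan x) (D' : Conn M) : Prop :=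
  ∀ (X : Π x : M, Tan x) (x : M), VecDiffAt X x → ∀ v : Tan x,
    D' X x v = D X x v - C x v (X x)

/-! ### Timelike curves -/

/-- A temporal orientation: a continuous field `τ_a` with `t_ab = τ_a τ_b`. -/
def IsTemporalOrientation (t : Π x : M, Tan x →L[ℝ] Cot x) (τ : Π x : M, Cot x) : Prop :=
  ContinuousCovec τ ∧ ∀ (x : M) (u w : Tan x), t x u w = τ x u * τ x w

/-- `γ` restricted to `J` is a smooth curve: `J` is an interval (not necessarily open), and `γ` is
smooth on some open interval containing it. -/
def IsSmoothCurve (γ : ℝ → M) (J : Set ℝ) : Prop :=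
  J.OrdConnected ∧ J.Nontrivial ∧
    ∃ U : Set ℝ, IsOpen U ∧ U.OrdConnected ∧ J ⊆ U ∧ ContMDiffOn 𝓘(ℝ, ℝ) 𝓘(ℝ, E4) ∞ γ U

/-- The tangent vector of `γ` at parameter `s`. -/
def velocity (γ : ℝ → M) (s : ℝ) : Tan (γ s) :=
  mfderiv 𝓘(ℝ, ℝ) 𝓘(ℝ, E4) γ s (1 : ℝ)

/-- The second derivative `d²x^a/ds²` of `γ` at parameter `s` in the preferred chart at `γ s`. -/
def coordAcceleration (γ : ℝ → M) (s : ℝ) : Tan (γ s) :=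
  (deriv (deriv (extChartAt 𝓘(ℝ, E4) (γ s) ∘ γ)) s : E4)

/-- The acceleration `ξ^n ∇_n ξ^a` at parameter `s` of the curve `γ` with tangent field `ξ^a`. In the
preferred chart at `γ s` this is `d²x^a/ds² + Γ^a_bc (dx^b/ds) (dx^c/ds)`, the Christoffel term
being the derivative of the coordinate-constant extension of the velocity. -/
def acceleration (D : Conn M) (γ : ℝ → M) (s : ℝ) : Tan (γ s) :=
  coordAcceleration γ s + D (FiberBundle.extend E4 (velocity γ s)) (γ s) (velocity γ s)

/-- `γ` on `J` is a timelike curve: future-directed and parametrized by its `t_ab`-length. -/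
def IsTimelikeCurve (t : Π x : M, Tan x →L[ℝ] Cot x) (τ : Π x : M, Cot x)
    (γ : ℝ → M) (J : Set ℝ) : Prop :=
  IsSmoothCurve γ J ∧
    ∀ s ∈ J, t (γ s) (velocity γ s) (velocity γ s) = 1 ∧ 0 < τ (γ s) (velocity γ s)

/-- `ξ^n ∇_n ξ^a = 0` all along the curve. -/
def IsGeodesic (D : Conn M) (γ : ℝ → M) (J : Set ℝ) : Prop :=
  ∀ s ∈ J, acceleration D γ s = 0

/-- The equation of motion `- ∇^a φ = ξ^n ∇_n ξ^a` holds all along the curve. -/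
def EquationOfMotion (h : Π x : M, Cot x →L[ℝ] Tan x) (D : Conn M) (φ : M → ℝ)
    (γ : ℝ → M) (J : Set ℝ) : Prop :=
  ∀ s ∈ J, -spatialGradient h φ (γ s) = acceleration D γ s

/-- For all timelike curves, `D'` counts the curve as a geodesic if and only if the curve satisfies
the equation of motion with respect to `D` and `φ`. -/
def Geometrizes (t : Π x : M, Tan x →L[ℝ] Cot x) (h : Π x : M, Cot x →L[ℝ] Tan x)
    (τ : Π x : M, Cot x) (D : Conn M) (φ : M → ℝ) (D' : Conn M) : Prop :=
  ∀ (γ : ℝ → M) (J : Set ℝ), IsTimelikeCurve t τ γ J →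
    (IsGeodesic D' γ J ↔ EquationOfMotion h D φ γ J)

end Fields

end NewtonCartan

end

open NewtonCartan

open scoped Topology

noncomputable section

namespace NewtonCartan

variable {M : Type*} [TopologicalSpace M] [ChartedSpace E4 M] [IsManifold 𝓘(ℝ, E4) ∞ M]
  {t : Π x : M, Tan x →L[ℝ] Cot x} {h : Π x : M, Cot x →L[ℝ] Tan x} {D Dg D' : Conn M}
  {φ : M → ℝ}

/-! Write `S` for the spatial gradient of `φ`. Everything about the operator `D + t ⊗ S` comes from
`t_ab S^b = 0`, the symmetry of `t`, and `∇t = 0`, `∇h = 0`. Symmetry keeps the torsion zero, and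
orthogonality makes the correction terms in `∇t` and `∇h` vanish
(`RelativeAction.isClassicalSpacetime`). A unit timelike velocity has its acceleration changed by
exactly `S`, which is the equivalence of geodesics and solution curves.

In the curvature the term quadratic in the correction vanishes because `t` kills `S`, and the terms
proportional to `S` cancel by `∇t = 0` and torsion-freeness. For flat `D` there remains `t_bc ∇_d
S^a - t_bd ∇_c S^a` (`RelativeAction.riemann_of_isFlat`). Its trace is the Laplacian times `t_bc`,
since `t_ba ∇_c S^a = 0`; raising `b` kills both terms; and the last identity is the symmetry of the
Hessian of `φ` (`hessian_symm`).

For uniqueness, a competitor has all timelike geodesics of the new operator among its own. Such a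
geodesic starts in every future-directed unit direction (`exists_timelike_geodesic`), so the
difference of the two operators, a symmetric bilinear map, vanishes on the diagonal of an open
half-space and therefore everywhere (`eq_zero_of_diag_eq_zero`). -/

/-! ### Regularity of tensor fields and their contractions. -/

lemma CovecDiffAt.apply {A : Π x : M, Cot x} {X : Π x : M, Tan x} {x : M}
    (hA : CovecDiffAt A x) (hX : VecDiffAt X x) :
    MDifferentiableAt 𝓘(ℝ, E4) 𝓘(ℝ, ℝ) (fun y ↦ A y (X y)) x := by
  have : MDifferentiableAt 𝓘(ℝ, E4) (𝓘(ℝ, E4).prod 𝓘(ℝ, ℝ))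
      (fun m ↦ TotalSpace.mk' ℝ (E := Bundle.Trivial M ℝ) m (A m (X m))) x :=
    MDifferentiableAt.clm_bundle_apply (F₁ := E4) (F₂ := ℝ) (b := fun m ↦ m) hA hX
  rw [mdifferentiableAt_totalSpace] at this
  exact this.2

lemma SmoothCovariant.apply {t : Π x : M, Tan x →L[ℝ] Cot x} (ht : SmoothCovariant t)
    {X : Π x : M, Tan x} {x : M} (hX : VecDiffAt X x) : CovecDiffAt (fun y ↦ t y (X y)) x :=
  MDifferentiableAt.clm_bundle_apply (F₁ := E4) (F₂ := E4 →L[ℝ] ℝ) (b := fun m ↦ m)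
    (ht.mdifferentiable (by simp) x) hX

lemma SmoothContravariant.apply {h : Π x : M, Cot x →L[ℝ] Tan x} (hh : SmoothContravariant h)
    {A : Π x : M, Cot x} {x : M} (hA : CovecDiffAt A x) : VecDiffAt (fun y ↦ h y (A y)) x :=
  MDifferentiableAt.clm_bundle_apply (F₁ := E4 →L[ℝ] ℝ) (F₂ := E4) (b := fun m ↦ m)
    (hh.mdifferentiable (by simp) x) hA

lemma vecDiffAt_extend {x : M} (v : Tan x) : VecDiffAt (FiberBundle.extend E4 v) x :=
  FiberBundle.mdifferentiableAt_extend 𝓘(ℝ, E4) E4 v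

lemma exists_covecDiffAt {x : M} (α : Cot x) : ∃ A : Π x : M, Cot x, CovecDiffAt A x ∧ A x = α :=
  ⟨FiberBundle.extend (E4 →L[ℝ] ℝ) (E := fun y : M ↦ TangentSpace 𝓘(ℝ, E4) y →L[ℝ] ℝ) α,
   FiberBundle.mdifferentiableAt_extend 𝓘(ℝ, E4) (E4 →L[ℝ] ℝ)
    (V := fun y : M ↦ TangentSpace 𝓘(ℝ, E4) y →L[ℝ] ℝ) α,
   FiberBundle.extend_apply_self _ _⟩

lemma contMDiff_covec_smulRight {A : Π x : M, Cot x} {S : Π x : M, Tan x}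
    (hA : ContMDiff 𝓘(ℝ, E4) (𝓘(ℝ, E4).prod 𝓘(ℝ, E4 →L[ℝ] ℝ)) ∞
      (fun y ↦ TotalSpace.mk' (E4 →L[ℝ] ℝ)
      (E := fun y : M ↦ TangentSpace 𝓘(ℝ, E4) y →L[ℝ] ℝ) y (A y)))
    (hS : ContMDiff 𝓘(ℝ, E4) (𝓘(ℝ, E4).prod 𝓘(ℝ, E4)) ∞
      (fun y ↦ TotalSpace.mk' E4 (E := fun y : M ↦ TangentSpace 𝓘(ℝ, E4) y) y (S y))) :
    ContMDiff 𝓘(ℝ, E4) (𝓘(ℝ, E4).prod 𝓘(ℝ, E4 →L[ℝ] E4)) ∞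
      (fun y ↦ TotalSpace.mk' (E4 →L[ℝ] E4)
      (E := fun y : M ↦ TangentSpace 𝓘(ℝ, E4) y →L[ℝ] TangentSpace 𝓘(ℝ, E4) y) y
        ((A y).smulRight (S y))) := by
  intro x
  have hA := hA x
  have hS := hS x
  rw [contMDiffAt_hom_bundle] at hA ⊢
  rw [contMDiffAt_section] at hS
  refine ⟨contMDiffAt_id, ?_⟩
  have key := (isBoundedBilinearMap_smulRight (𝕜 := ℝ) (E := E4) (F := E4)).contDiff.contMDiff.contMDiffAt.comp x
    (hA.2.prodMk_space hS)
  refine key.congr_of_eventuallyEq ?_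
  filter_upwards [(trivializationAt E4 (fun y : M ↦ TangentSpace 𝓘(ℝ, E4) y) x).open_baseSet.mem_nhds
    (FiberBundle.mem_baseSet_trivializationAt' x)] with y hy
  ext1 v
  simp [ContinuousLinearMap.inCoordinates, Trivialization.coe_linearMapAt_of_mem _ hy]

lemma contMDiff_dScalar {φ : M → ℝ} (hφ : ContMDiff 𝓘(ℝ, E4) 𝓘(ℝ, ℝ) ∞ φ) :
    ContMDiff 𝓘(ℝ, E4) (𝓘(ℝ, E4).prod 𝓘(ℝ, E4 →L[ℝ] ℝ)) ∞
      (fun y ↦ TotalSpace.mk' (E4 →L[ℝ] ℝ)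
      (E := fun y : M ↦ TangentSpace 𝓘(ℝ, E4) y →L[ℝ] ℝ) y (dScalar φ y)) := by
  intro x
  rw [contMDiffAt_hom_bundle]
  refine ⟨contMDiffAt_id, ?_⟩
  have := (hφ x).mfderiv_const (m := ∞) (by simp)
  refine this.congr_of_eventuallyEq ?_
  filter_upwards [(trivializationAt E4 (fun y : M ↦ TangentSpace 𝓘(ℝ, E4) y) x).open_baseSet.mem_nhds
    (FiberBundle.mem_baseSet_trivializationAt' x)] with y hy
  ext1 v
  simp [inTangentCoordinates, ContinuousLinearMap.inCoordinates, dScalar, mvfderiv]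
  rfl

lemma contMDiff_spatialGradient {h : Π x : M, Cot x →L[ℝ] Tan x} (hh : SmoothContravariant h)
    {φ : M → ℝ} (hφ : ContMDiff 𝓘(ℝ, E4) 𝓘(ℝ, ℝ) ∞ φ) :
    ContMDiff 𝓘(ℝ, E4) (𝓘(ℝ, E4).prod 𝓘(ℝ, E4)) ∞
      (fun y ↦ TotalSpace.mk' E4 (E := fun y : M ↦ TangentSpace 𝓘(ℝ, E4) y) y
        (spatialGradient h φ y)) :=
  ContMDiff.clm_bundle_apply (F₁ := E4 →L[ℝ] ℝ) (F₂ := E4) (b := fun m ↦ m) hh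
    (contMDiff_dScalar hφ)

lemma IsDerivativeOperator.torsion_apply {D : Conn M} (hD : IsDerivativeOperator D)
    {X Y : Π x : M, Tan x} {x : M} (hX : VecDiffAt X x) (hY : VecDiffAt Y x) :
    D Y x (X x) - D X x (Y x) = VectorField.mlieBracket 𝓘(ℝ, E4) X Y x :=
  D.torsion_eq_zero_iff.1 hD.torsion_free hX hY

lemma isDerivativeOperator_of {D : Conn M} (hs : D.ContMDiffCovariantDerivative ∞)
    (ht : ∀ {X Y : Π x : M, Tan x} {x : M}, VecDiffAt X x → VecDiffAt Y x →
      D Y x (X x) - D X x (Y x) = VectorField.mlieBracket 𝓘(ℝ, E4) X Y x) :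
    IsDerivativeOperator D :=
  ⟨hs, D.torsion_eq_zero_iff.2 ht⟩

/-- The derivatives of a factor `f` in the two Leibniz rules cancel. Hence the chart-constant
extension in `covDerivCovec` may be replaced by any differentiable one, as `covDerivCovec_eq`
records. -/
lemma tensorialAt_covDerivCovec (D : Conn M) {A : Π x : M, Cot x} {x : M} (hA : CovecDiffAt A x)
    (v : Tan x) : TensorialAt 𝓘(ℝ, E4) E4
      (fun W : Π x : M, Tan x ↦ dScalar (fun y ↦ A y (W y)) x v - A x (D W x v)) x where
  smul {f σ} hf hσ := by
    have := D.isCovariantDerivativeOnUniv.leibniz hσ hf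
    simp only [this]
    have h2 := mvfderiv_fun_mul hf (hA.apply hσ)
    simp [dScalar, h2]
    ring
  add {σ σ'} hσ hσ' := by
    have := D.isCovariantDerivativeOnUniv.add hσ hσ'
    simp only [this]
    have h2 := mvfderiv_fun_add (hA.apply hσ) (hA.apply hσ')
    simp [dScalar, h2]
    ring

lemma covDerivCovec_eq (D : Conn M) {A : Π x : M, Cot x} {x : M} (hA : CovecDiffAt A x)
    {W : Π x : M, Tan x} (hW : VecDiffAt W x) (v : Tan x) :
    covDerivCovec D A x v (W x) = dScalar (fun y ↦ A y (W y)) x v - A x (D W x v) :=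
  (tensorialAt_covDerivCovec D hA v).pointwise (vecDiffAt_extend _) hW (by simp)

/-! ### Coordinate vector fields and symmetry of the Hessian. -/

/-- The vector field with constant components `w` in the preferred chart at `x`. -/
def chartField (x : M) (w : E4) (y : M) : Tan y :=
  FiberBundle.extend E4 (E := fun y : M ↦ TangentSpace 𝓘(ℝ, E4) y) (x := x) w y

@[simp] lemma chartField_self (x : M) (w : E4) : chartField x w x = w :=
  FiberBundle.extend_apply_self _ _

/-- The trivialization at `x` is the derivative of the chart, which is the identity on the fibre
over `x` itself. This turns extensions into honest coordinate fields, open to calculus in `E4`. -/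
lemma chartField_eq_mfderiv_symm (x : M) (w : E4) {y : M}
    (hy : y ∈ (extChartAt 𝓘(ℝ, E4) x).source) :
    chartField x w y =
      mfderiv 𝓘(ℝ, E4) 𝓘(ℝ, E4) (extChartAt 𝓘(ℝ, E4) x).symm (extChartAt 𝓘(ℝ, E4) x y) w := by
  rw [extChartAt_source] at hy
  have := TangentBundle.symmL_trivializationAt (I := 𝓘(ℝ, E4)) hy
  rw [ModelWithCorners.range_eq_univ, mfderivWithin_univ] at this
  refine Eq.trans ?_ congr($this w)
  have h3 := congr($(TangentBundle.continuousLinearMapAt_trivializationAt (I := 𝓘(ℝ, E4))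
    (mem_chart_source E4 x)) w)
  rw [mfderiv_extChartAt_self] at h3
  have h4 : (trivializationAt E4 (TangentSpace 𝓘(ℝ, E4)) x ⟨x, w⟩).2 = w :=
    Eq.trans (congrFun (Trivialization.coe_linearMapAt_of_mem (R := ℝ)
      (trivializationAt E4 (TangentSpace 𝓘(ℝ, E4)) x)
      (FiberBundle.mem_baseSet_trivializationAt' x)) w).symm h3
  exact (congrArg ((trivializationAt E4 (TangentSpace 𝓘(ℝ, E4)) x).symm y) h4).trans
    (Trivialization.symmL_apply _ hy w).symm

lemma chartField_mfderiv_extChartAt (x : M) {y : M} (hy : y ∈ (extChartAt 𝓘(ℝ, E4) x).source)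
    (u : Tan y) :
    chartField x (mfderiv 𝓘(ℝ, E4) 𝓘(ℝ, E4) (extChartAt 𝓘(ℝ, E4) x) y u) y = u := by
  refine (chartField_eq_mfderiv_symm x _ hy).trans ?_
  have := mfderivWithin_extChartAt_symm_comp_mfderiv_extChartAt' (I := 𝓘(ℝ, E4)) hy
  rw [ModelWithCorners.range_eq_univ, mfderivWithin_univ] at this
  exact congr($this u)

lemma mpullback_chartField (x : M) (w : E4) {z : E4} (hz : z ∈ (extChartAt 𝓘(ℝ, E4) x).target) :
    VectorField.mpullback 𝓘(ℝ, E4) 𝓘(ℝ, E4) (extChartAt 𝓘(ℝ, E4) x).symm (chartField x w) z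
      = w := by
  rw [VectorField.mpullback_apply,
    chartField_eq_mfderiv_symm x w ((extChartAt 𝓘(ℝ, E4) x).map_target hz),
    (extChartAt 𝓘(ℝ, E4) x).right_inv hz]
  have := isInvertible_mfderivWithin_extChartAt_symm (I := 𝓘(ℝ, E4)) hz
  rw [ModelWithCorners.range_eq_univ, mfderivWithin_univ] at this
  exact this.inverse_apply_eq.2 rfl

/-- Pulled back to the chart, both fields are constant near the image of `x`. -/
lemma mlieBracket_chartField (x : M) (v w : E4) :
    VectorField.mlieBracket 𝓘(ℝ, E4) (chartField x v) (chartField x w) x = 0 := by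
  rw [← VectorField.mlieBracketWithin_univ, VectorField.mlieBracketWithin_apply]
  simp only [ModelWithCorners.range_eq_univ, VectorField.mpullbackWithin_univ, preimage_univ,
    univ_inter]
  have h (w : E4) : VectorField.mpullback 𝓘(ℝ, E4) 𝓘(ℝ, E4) (extChartAt 𝓘(ℝ, E4) x).symm
      (chartField x w) =ᶠ[𝓝 (extChartAt 𝓘(ℝ, E4) x x)] fun _ ↦ w := by
    filter_upwards [extChartAt_target_mem_nhds (I := 𝓘(ℝ, E4)) x] with z hz
      using mpullback_chartField x w hz
  have h2 := Filter.EventuallyEq.lieBracket_vectorField_eq (𝕜 := ℝ) (h v) (h w)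
  have h3 : VectorField.lieBracket ℝ (fun _ : E4 ↦ v) (fun _ ↦ w) (extChartAt 𝓘(ℝ, E4) x x) = 0 := by
    simp [VectorField.lieBracket]
  have h0 (V W : E4 → E4) :
      VectorField.lieBracketWithin ℝ V W univ = VectorField.lieBracket ℝ V W :=
    VectorField.lieBracketWithin_univ
  exact (congrArg (mfderiv 𝓘(ℝ, E4) 𝓘(ℝ, E4) (extChartAt 𝓘(ℝ, E4) x) x).inverse
    ((congrFun (h0 _ _) _).trans (h2.trans h3))).trans (map_zero _)

lemma mdifferentiableAt_extChartAt_symm (x : M) {z : E4}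
    (hz : z ∈ (extChartAt 𝓘(ℝ, E4) x).target) :
    MDifferentiableAt 𝓘(ℝ, E4) 𝓘(ℝ, E4) (extChartAt 𝓘(ℝ, E4) x).symm z := by
  have := mdifferentiableWithinAt_extChartAt_symm (I := 𝓘(ℝ, E4)) hz
  rwa [ModelWithCorners.range_eq_univ, mdifferentiableWithinAt_univ] at this

lemma dScalar_apply_eq_fderiv {f : E4 → ℝ} {g : M → ℝ} {x : M}
    (hg : g =ᶠ[𝓝 x] f ∘ extChartAt 𝓘(ℝ, E4) x)
    (hf : DifferentiableAt ℝ f (extChartAt 𝓘(ℝ, E4) x x)) (v : Tan x) :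
    dScalar g x v = fderiv ℝ f (extChartAt 𝓘(ℝ, E4) x x) v := by
  rw [dScalar, mvfderiv, hg.mfderiv_eq]
  refine (mvfderiv_comp_apply x hf.mdifferentiableAt
    (mdifferentiableAt_extChartAt (I := 𝓘(ℝ, E4)) (mem_chart_source E4 x)) v).trans ?_
  rw [mfderiv_extChartAt_self, mvfderiv, mfderiv_eq_fderiv]
  rfl

/-- Both sides are mixed second partial derivatives of `φ` read in the chart at `x`. -/
lemma dScalar_chartField_symm {φ : M → ℝ} (hφ : ContMDiff 𝓘(ℝ, E4) 𝓘(ℝ, ℝ) ∞ φ) (x : M)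
    (v w : E4) :
    dScalar (fun y ↦ dScalar φ y (chartField x w y)) x v =
      dScalar (fun y ↦ dScalar φ y (chartField x v y)) x w := by
  set e := extChartAt 𝓘(ℝ, E4) x
  have hψ : ContDiffOn ℝ ∞ (φ ∘ e.symm) e.target := by
    rw [← contMDiffOn_iff_contDiffOn]
    exact hφ.comp_contMDiffOn (contMDiffOn_extChartAt_symm x)
  have hψ' : ContDiffAt ℝ ∞ (φ ∘ e.symm) (e x) := hψ.contDiffAt (extChartAt_target_mem_nhds x)
  have h6 : DifferentiableAt ℝ (fderiv ℝ (φ ∘ e.symm)) (e x) :=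
    (hψ'.fderiv_right (m := ∞) (by simp)).differentiableAt (by simp)
  have key (v w : E4) : dScalar (fun y ↦ dScalar φ y (chartField x w y)) x v =
      fderiv ℝ (fderiv ℝ (φ ∘ e.symm)) (e x) v w := by
    have h1 : (fun y ↦ dScalar φ y (chartField x w y)) =ᶠ[𝓝 x]
        (fun z ↦ fderiv ℝ (φ ∘ e.symm) z w) ∘ e := by
      filter_upwards [extChartAt_source_mem_nhds (I := 𝓘(ℝ, E4)) x] with y hy
      rw [chartField_eq_mfderiv_symm x w hy]
      have h3 := mvfderiv_comp_apply_of_eq (e y) (hφ.mdifferentiable (by simp) y)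
        (mdifferentiableAt_extChartAt_symm x (e.map_source hy)) (e.left_inv hy) w
      refine h3.symm.trans ?_
      rw [mvfderiv, mfderiv_eq_fderiv]
      rfl
    refine (dScalar_apply_eq_fderiv h1 (h6.clm_apply (by fun_prop)) v).trans ?_
    rw [fderiv_clm_apply h6 (by fun_prop)]
    simp
  refine (key v w).trans (.trans ?_ (key w v).symm)
  refine hψ'.isSymmSndFDerivAt ?_ v w
  rw [minSmoothness_of_isRCLikeNormedField]
  exact WithTop.coe_le_coe.2 le_top

/-- Coordinate fields commute at `x`, so zero torsion makes the Christoffel terms agree; the rest is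
equality of mixed partials. -/
lemma hessian_symm {D : Conn M} (hD : IsDerivativeOperator D) {φ : M → ℝ}
    (hφ : ContMDiff 𝓘(ℝ, E4) 𝓘(ℝ, ℝ) ∞ φ) (x : M) (v w : Tan x) :
    covDerivCovec D (dScalar φ) x v w = covDerivCovec D (dScalar φ) x w v := by
  have := hD.torsion_apply (vecDiffAt_extend v) (vecDiffAt_extend w)
  simp only [FiberBundle.extend_apply_self] at this
  rw [show VectorField.mlieBracket 𝓘(ℝ, E4) (FiberBundle.extend E4 v) (FiberBundle.extend E4 w) x
    = 0 from mlieBracket_chartField x v w, sub_eq_zero] at this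
  rw [covDerivCovec, covDerivCovec, this]
  congr 1
  exact dScalar_chartField_symm hφ x v w

/-! ### Covariant derivatives of locally smooth fields. -/

lemma exists_contMDiff_eventuallyEq [T2Space M] {X : Π x : M, Tan x} {x : M} {u : Set M} (hu : u ∈ 𝓝 x)
    (hX : ContMDiffOn 𝓘(ℝ, E4) (𝓘(ℝ, E4).prod 𝓘(ℝ, E4)) ∞
      (fun y ↦ TotalSpace.mk' E4 (E := fun y : M ↦ TangentSpace 𝓘(ℝ, E4) y) y (X y)) u) :
    ∃ Y : Π x : M, Tan x, ContMDiff 𝓘(ℝ, E4) (𝓘(ℝ, E4).prod 𝓘(ℝ, E4)) ∞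
      (fun y ↦ TotalSpace.mk' E4 (E := fun y : M ↦ TangentSpace 𝓘(ℝ, E4) y) y (Y y)) ∧
      ∀ᶠ y in 𝓝 x, Y y = X y := by
  obtain ⟨f, hf, -⟩ := (SmoothBumpFunction.nhds_basis_support (I := 𝓘(ℝ, E4)) (interior_mem_nhds.2 hu)).mem_iff.1 Filter.univ_mem
  refine ⟨(f : M → ℝ) • X, ContMDiffOn.smul_section_of_tsupport f.contMDiff.contMDiffOn isOpen_interior hf
    (hX.mono interior_subset), ?_⟩
  filter_upwards [f.eventuallyEq_one] with y hy
  simp [hy]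

/-- Smoothness of `D` speaks only of globally smooth fields, whereas coordinate fields are smooth
only on a chart domain. A bump function supplies a global field with the same germ, and `D` is
local. -/
lemma contMDiffAt_conn [T2Space M] {D : Conn M} (hD : D.ContMDiffCovariantDerivative ∞)
    {X : Π x : M, Tan x} {x : M} {u : Set M} (hu : u ∈ 𝓝 x)
    (hX : ContMDiffOn 𝓘(ℝ, E4) (𝓘(ℝ, E4).prod 𝓘(ℝ, E4)) ∞
      (fun y ↦ TotalSpace.mk' E4 (E := fun y : M ↦ TangentSpace 𝓘(ℝ, E4) y) y (X y)) u) :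
    ContMDiffAt 𝓘(ℝ, E4) (𝓘(ℝ, E4).prod 𝓘(ℝ, E4 →L[ℝ] E4)) ∞
      (fun y ↦ TotalSpace.mk' (E4 →L[ℝ] E4)
      (E := fun y : M ↦ TangentSpace 𝓘(ℝ, E4) y →L[ℝ] TangentSpace 𝓘(ℝ, E4) y) y (D X y)) x := by
  obtain ⟨Y, hY, hYX⟩ := exists_contMDiff_eventuallyEq hu hX
  have h1 := (contMDiffOn_univ.1 (hD.contMDiff.contMDiff (σ := Y) hY.contMDiffOn)) x
  refine h1.congr_of_eventuallyEq ?_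
  filter_upwards [hYX.eventually_nhds, eventually_eventually_nhds.2 hu] with y hy hyu
  congr 1
  exact (D.isCovariantDerivativeOnUniv.congr_of_eventuallyEq (hY.mdifferentiable (by simp) y)
    ((hX.contMDiffAt hyu).mdifferentiableAt (by simp)) Filter.univ_mem hy).symm

lemma contMDiffOn_chartField (x : M) (w : E4) :
    ContMDiffOn 𝓘(ℝ, E4) (𝓘(ℝ, E4).prod 𝓘(ℝ, E4)) ∞
      (fun y ↦ TotalSpace.mk' E4 (E := fun y : M ↦ TangentSpace 𝓘(ℝ, E4) y) y
        (chartField x w y)) (chartAt E4 x).source := by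
  let e := trivializationAt E4 (fun y : M ↦ TangentSpace 𝓘(ℝ, E4) y) x
  intro y hy
  rw [e.contMDiffWithinAt_section _ hy]
  have : ContMDiffOn 𝓘(ℝ, E4) 𝓘(ℝ, E4) ∞
      (fun (_ : M) ↦ (e ⟨x, w⟩).2) (chartAt E4 x).source := contMDiffOn_const
  refine (this.congr fun z hz ↦ ?_) y hy
  simp only [chartField, FiberBundle.extend]
  rw [Trivialization.apply_mk_symm]
  exact hz

lemma contMDiffAt_conn_chartField [T2Space M] {D : Conn M}
    (hD : D.ContMDiffCovariantDerivative ∞) {x y : M} (hy : y ∈ (chartAt E4 x).source) (w : E4) :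
    ContMDiffAt 𝓘(ℝ, E4) (𝓘(ℝ, E4).prod 𝓘(ℝ, E4 →L[ℝ] E4)) ∞
      (fun y ↦ TotalSpace.mk' (E4 →L[ℝ] E4)
      (E := fun y : M ↦ TangentSpace 𝓘(ℝ, E4) y →L[ℝ] TangentSpace 𝓘(ℝ, E4) y) y
      (D (chartField x w) y)) y :=
  contMDiffAt_conn hD ((chartAt E4 x).open_source.mem_nhds hy) (contMDiffOn_chartField x w)

lemma vecDiffAt_conn_extend [T2Space M] {D : Conn M} (hD : D.ContMDiffCovariantDerivative ∞)
    {x : M} (w : Tan x) {Y : Π x : M, Tan x} (hY : VecDiffAt Y x) :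
    VecDiffAt (fun y ↦ D (FiberBundle.extend E4 w) y (Y y)) x :=
  MDifferentiableAt.clm_bundle_apply (F₁ := E4) (F₂ := E4) (b := fun m ↦ m)
    ((contMDiffAt_conn_chartField hD (mem_chart_source E4 x) w).mdifferentiableAt (by simp)) hY

lemma IsClassicalSpacetime.t_symm (hST : IsClassicalSpacetime t h D) (x : M) (u w : Tan x) :
    t x u w = t x w u := (hST.t_signature x).1 u w

lemma IsClassicalSpacetime.orthogonal' (hST : IsClassicalSpacetime t h D) (x : M) (w : Tan x)
    (α : Cot x) : t x w (h x α) = 0 := by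
  rw [hST.t_symm, hST.orthogonal]

lemma vecDiffAt_spatialGradient (hh : SmoothContravariant h)
    (hφ : ContMDiff 𝓘(ℝ, E4) 𝓘(ℝ, ℝ) ∞ φ) (x : M) : VecDiffAt (spatialGradient h φ) x :=
  (contMDiff_spatialGradient hh hφ).mdifferentiable (by simp) x

lemma covecDiffAt_dScalar (hφ : ContMDiff 𝓘(ℝ, E4) 𝓘(ℝ, ℝ) ∞ φ) (x : M) :
    CovecDiffAt (dScalar φ) x :=
  (contMDiff_dScalar hφ).mdifferentiable (by simp) x

/-! ### The geometrized derivative operator -/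

/-- The operator `D + t_bc ∇^a φ`. -/
def geometrization (t : Π x : M, Tan x →L[ℝ] Cot x) (h : Π x : M, Cot x →L[ℝ] Tan x) (D : Conn M)
    (φ : M → ℝ) : Conn M :=
  D.addOneForm fun x ↦
    ((ContinuousLinearMap.smulRightL ℝ E4 E4).flip (spatialGradient h φ x : E4)).comp
      (t x : E4 →L[ℝ] E4 →L[ℝ] ℝ)

lemma geometrization_apply (t : Π x : M, Tan x →L[ℝ] Cot x) (h : Π x : M, Cot x →L[ℝ] Tan x)
    (D : Conn M) (φ : M → ℝ) (X : Π x : M, Tan x) (x : M) (v : Tan x) :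
    geometrization t h D φ X x v = D X x v + t x (X x) v • spatialGradient h φ x := rfl

lemma relativeAction_geometrization (hST : IsClassicalSpacetime t h D) :
    RelativeAction D (geomTensor t h φ) (geometrization t h D φ) := by
  intro X x _ v
  rw [geometrization_apply, geomTensor, hST.t_symm, sub_neg_eq_add]

lemma RelativeAction.apply (hD : RelativeAction D (geomTensor t h φ) Dg) {X : Π x : M, Tan x}
    {x : M} (hX : VecDiffAt X x) (v : Tan x) :
    Dg X x v = D X x v + t x v (X x) • spatialGradient h φ x := by
  rw [hD X x hX v, geomTensor, sub_neg_eq_add]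

lemma RelativeAction.covDerivCovec_eq (hD : RelativeAction D (geomTensor t h φ) Dg) (A : Π x : M, Cot x)
    {x : M} (v w : Tan x) :
    covDerivCovec Dg A x v w = covDerivCovec D A x v w - t x v w * A x (spatialGradient h φ x) := by
  rw [covDerivCovec, covDerivCovec, hD.apply (vecDiffAt_extend w)]
  simp
  ring

lemma RelativeAction.isDerivativeOperator (hD : RelativeAction D (geomTensor t h φ) Dg)
    (hST : IsClassicalSpacetime t h D) (hφ : ContMDiff 𝓘(ℝ, E4) 𝓘(ℝ, ℝ) ∞ φ) :
    IsDerivativeOperator Dg := by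
  refine isDerivativeOperator_of ⟨⟨fun {σ} hσ ↦ ?_⟩⟩ fun {X Y x} hX hY ↦ ?_
  · have h1 := hST.derivative_operator.smooth.contMDiff.contMDiff hσ
    rw [contMDiffOn_univ] at h1 ⊢
    have hσ' := contMDiffOn_univ.1 hσ
    have h2 := contMDiff_covec_smulRight (A := fun y ↦ t y (σ y))
      (ContMDiff.clm_bundle_apply (F₁ := E4) (F₂ := E4 →L[ℝ] ℝ) (b := fun m ↦ m) hST.t_smooth hσ')
      (contMDiff_spatialGradient hST.h_smooth hφ)
    have h3 := ContMDiff.add_section h1 h2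
    convert h3 using 2 with y
    congr 1
    ext1 v
    rw [hD.apply (hσ'.mdifferentiable (by simp) y), hST.t_symm]
    rfl
  · rw [hD.apply hX, hD.apply hY, ← hST.derivative_operator.torsion_apply hX hY, hST.t_symm]
    abel

/-- The corrections to `∇t` contain `t` applied to `S`, and those to `∇h` contain `t` applied to a
raised covector; both are zero by orthogonality. -/
lemma RelativeAction.isClassicalSpacetime (hD : RelativeAction D (geomTensor t h φ) Dg)
    (hST : IsClassicalSpacetime t h D) (hφ : ContMDiff 𝓘(ℝ, E4) 𝓘(ℝ, ℝ) ∞ φ) :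
    IsClassicalSpacetime t h Dg where
  t_smooth := hST.t_smooth
  t_signature := hST.t_signature
  h_smooth := hST.h_smooth
  h_signature := hST.h_signature
  derivative_operator := hD.isDerivativeOperator hST hφ
  orthogonal := hST.orthogonal
  t_compatible X Y x hX hY v := by
    rw [hD.apply hX, hD.apply hY, ← hST.t_compatible X Y x hX hY v]
    simp [spatialGradient, hST.orthogonal, hST.orthogonal']
  h_compatible A B x hA hB v := by
    rw [hD.covDerivCovec_eq, hD.covDerivCovec_eq, ← hST.h_compatible A B x hA hB v]
    simp [hST.orthogonal']

/-! ### Its curvature -/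

lemma eventually_vecDiffAt_extend {x : M} (w : Tan x) :
    ∀ᶠ y in 𝓝 x, VecDiffAt (FiberBundle.extend E4 w) y := by
  filter_upwards [(chartAt E4 x).open_source.mem_nhds (mem_chart_source E4 x)] with y hy
  exact ((contMDiffOn_chartField x w).contMDiffAt ((chartAt E4 x).open_source.mem_nhds hy)).mdifferentiableAt
    (by simp)

/-- Near `x` the inner derivative is `P + f • S` with `f = t(Y, Z)`. The Leibniz rule expands the
outer one, and `∇t = 0` evaluates the differential of `f`. -/
lemma RelativeAction.conn_conn_extend [T2Space M] (hD : RelativeAction D (geomTensor t h φ) Dg)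
    (hST : IsClassicalSpacetime t h D) (hφ : ContMDiff 𝓘(ℝ, E4) 𝓘(ℝ, ℝ) ∞ φ) {x : M}
    (u v w : Tan x) :
    Dg (fun y ↦ Dg (FiberBundle.extend E4 u) y (FiberBundle.extend E4 w y)) x v =
      D (fun y ↦ D (FiberBundle.extend E4 u) y (FiberBundle.extend E4 w y)) x v
      + t x w u • D (spatialGradient h φ) x v
      + (t x (D (FiberBundle.extend E4 w) x v) u + t x w (D (FiberBundle.extend E4 u) x v)
        + t x v (D (FiberBundle.extend E4 u) x w)) • spatialGradient h φ x := by
  have hZ := vecDiffAt_extend u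
  have hY := vecDiffAt_extend w
  have hS := vecDiffAt_spatialGradient hST.h_smooth hφ x
  set Z := FiberBundle.extend E4 u
  set Y := FiberBundle.extend E4 w
  have hZx : Z x = u := FiberBundle.extend_apply_self _ _
  have hYx : Y x = w := FiberBundle.extend_apply_self _ _
  set S := spatialGradient h φ with hSdef
  set P : Π y : M, Tan y := fun y ↦ D Z y (Y y)
  have hP : VecDiffAt P x := vecDiffAt_conn_extend hST.derivative_operator.smooth u hY
  set f : M → ℝ := fun y ↦ t y (Y y) (Z y)
  have hf : MDifferentiableAt 𝓘(ℝ, E4) 𝓘(ℝ, ℝ) f x := (hST.t_smooth.apply hY).apply hZ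
  have hfS : VecDiffAt (f • S) x := MDifferentiableAt.smul_section hf hS
  have hPfS : VecDiffAt (P + f • S) x := mdifferentiableAt_add_section hP hfS
  have hev : ∀ᶠ y in 𝓝 x, Dg Z y (Y y) = (P + f • S) y := by
    filter_upwards [eventually_vecDiffAt_extend u] with y hy
    exact hD.apply hy (Y y)
  have hdiff : VecDiffAt (fun y ↦ Dg Z y (Y y)) x := by
    refine MDifferentiableAt.congr_of_eventuallyEq hPfS ?_
    filter_upwards [hev] with y hy
    simp [hy]
  have h1 := Dg.isCovariantDerivativeOnUniv.congr_of_eventuallyEq hdiff hPfS Filter.univ_mem hev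
  rw [h1, hD.apply hPfS, D.isCovariantDerivativeOnUniv.add hP hfS,
    D.isCovariantDerivativeOnUniv.leibniz hS hf]
  have h2 : dScalar f x v = t x (D Y x v) (Z x) + t x (Y x) (D Z x v) := by
    have := hST.t_compatible Y Z x hY hZ v
    rw [sub_sub, sub_eq_zero] at this
    exact this
  -- This removes the term quadratic in the correction.
  have h3 : t x v (S x) = 0 := hST.orthogonal' ..
  have h4 : mvfderiv 𝓘(ℝ, E4) f x v = t x (D Y x v) (Z x) + t x (Y x) (D Z x v) := h2
  simp only [Pi.add_apply, Pi.smul_apply', add_apply, smul_apply,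
    ContinuousLinearMap.smulRight_apply, map_add, map_smul, h3, h4, hYx, hZx, f, P]
  module

/-- After antisymmetrization the multiple of `S` left over is `t(∇_v W - ∇_w V, u)`, which the
bracket term cancels because the torsion is zero. -/
lemma RelativeAction.riemann_eq [T2Space M] (hD : RelativeAction D (geomTensor t h φ) Dg)
    (hST : IsClassicalSpacetime t h D) (hφ : ContMDiff 𝓘(ℝ, E4) 𝓘(ℝ, ℝ) ∞ φ) {x : M}
    (u v w : Tan x) :
    riemann Dg x u v w = riemann D x u v w + t x v u • D (spatialGradient h φ) x w
      - t x w u • D (spatialGradient h φ) x v := by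
  simp only [riemann, curvatureOp, FiberBundle.extend_apply_self]
  rw [hD.conn_conn_extend hST hφ, hD.conn_conn_extend hST hφ, hD.apply (vecDiffAt_extend u),
    ← hST.derivative_operator.torsion_apply (vecDiffAt_extend v) (vecDiffAt_extend w)]
  simp only [FiberBundle.extend_apply_self, map_sub, sub_apply]
  module

/-- Differentiate `t_ab S^b = 0` and use `∇t = 0`. -/
lemma IsClassicalSpacetime.t_conn_spatialGradient (hST : IsClassicalSpacetime t h D)
    (hφ : ContMDiff 𝓘(ℝ, E4) 𝓘(ℝ, ℝ) ∞ φ) (x : M) (u v : Tan x) :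
    t x u (D (spatialGradient h φ) x v) = 0 := by
  have := hST.t_compatible _ _ x (vecDiffAt_extend u) (vecDiffAt_spatialGradient hST.h_smooth hφ x) v
  simpa [spatialGradient, hST.orthogonal', dScalar, mvfderiv_const] using this

/-- Since `∇h = 0`, raising an index commutes with differentiation: `∇_n S^a = h^ab ∇_n ∇_b φ`. -/
lemma IsClassicalSpacetime.covec_conn_spatialGradient (hST : IsClassicalSpacetime t h D)
    (hφ : ContMDiff 𝓘(ℝ, E4) 𝓘(ℝ, ℝ) ∞ φ) (x : M) (α : Cot x) (v : Tan x) :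
    α (D (spatialGradient h φ) x v) = covDerivCovec D (dScalar φ) x v (h x α) := by
  obtain ⟨A, hA, rfl⟩ := exists_covecDiffAt α
  have h1 := hST.h_compatible A (dScalar φ) x hA (covecDiffAt_dScalar hφ x) v
  have h2 := covDerivCovec_eq D hA (vecDiffAt_spatialGradient hST.h_smooth hφ x) v
  simp only [spatialGradient] at h2 ⊢
  rw [h2] at h1
  linarith

lemma RelativeAction.riemann_of_isFlat [T2Space M] (hD : RelativeAction D (geomTensor t h φ) Dg)
    (hST : IsClassicalSpacetime t h D) (hflat : IsFlat D) (hφ : ContMDiff 𝓘(ℝ, E4) 𝓘(ℝ, ℝ) ∞ φ)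
    {x : M} (u v w : Tan x) :
    riemann Dg x u v w = t x v u • D (spatialGradient h φ) x w
      - t x w u • D (spatialGradient h φ) x v := by
  rw [hD.riemann_eq hST hφ, hflat, zero_add]

lemma IsClassicalSpacetime.trace_conn_spatialGradient (hST : IsClassicalSpacetime t h D)
    (hφ : ContMDiff 𝓘(ℝ, E4) 𝓘(ℝ, ℝ) ∞ φ) (x : M) :
    ∑ i, coframe x i (D (spatialGradient h φ) x (frame x i)) = laplacian h D φ x :=
  Finset.sum_congr rfl fun i _ ↦ by
    rw [hST.covec_conn_spatialGradient hφ, hessian_symm hST.derivative_operator hφ]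

lemma sum_coframe_smul_frame (x : M) (w : Tan x) : ∑ i, coframe x i w • frame x i = w := by
  have := (EuclideanSpace.basisFun (Fin 4) ℝ).sum_repr (w : E4)
  simp only [EuclideanSpace.basisFun_apply] at this
  exact this

lemma RelativeAction.ricci_eq [T2Space M] (hD : RelativeAction D (geomTensor t h φ) Dg)
    (hST : IsClassicalSpacetime t h D) (hflat : IsFlat D) (hφ : ContMDiff 𝓘(ℝ, E4) 𝓘(ℝ, ℝ) ∞ φ)
    (x : M) (u v : Tan x) : ricci Dg x u v = laplacian h D φ x * t x u v := by
  -- The trace of the second curvature term is the contraction `t_ba ∇_c S^a`.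
  have h1 : ∑ i, t x (frame x i) u * coframe x i (D (spatialGradient h φ) x v) = 0 := by
    rw [← hST.t_conn_spatialGradient hφ x u v]
    conv_rhs => rw [← sum_coframe_smul_frame x (D (spatialGradient h φ) x v)]
    rw [map_sum]
    refine Finset.sum_congr rfl fun i _ ↦ ?_
    rw [map_smul, hST.t_symm, smul_eq_mul, mul_comm]
  simp only [ricci, hD.riemann_of_isFlat hST hflat hφ, map_sub, map_smul, smul_eq_mul,
    Finset.sum_sub_distrib, h1, ← Finset.mul_sum, hST.trace_conn_spatialGradient hφ]
  rw [hST.t_symm, sub_zero, mul_comm]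

lemma RelativeAction.riemannUpUp_eq_zero [T2Space M]
    (hD : RelativeAction D (geomTensor t h φ) Dg)
    (hST : IsClassicalSpacetime t h D) (hflat : IsFlat D) (hφ : ContMDiff 𝓘(ℝ, E4) 𝓘(ℝ, ℝ) ∞ φ)
    (x : M) (α β : Cot x) (v w : Tan x) : riemannUpUp h Dg x α β v w = 0 := by
  simp [riemannUpUp, hD.riemann_of_isFlat hST hflat hφ, hST.orthogonal']

/-- Only `-t_bd ∇^c ∇^a φ` survives. It is symmetric in `a, c`, which is why the antisymmetrization
below gives zero. -/
lemma RelativeAction.riemannMixed_eq [T2Space M] (hD : RelativeAction D (geomTensor t h φ) Dg)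
    (hST : IsClassicalSpacetime t h D) (hflat : IsFlat D) (hφ : ContMDiff 𝓘(ℝ, E4) 𝓘(ℝ, ℝ) ∞ φ)
    (x : M) (α κ : Cot x) (u w : Tan x) : riemannMixed h Dg x α u κ w =
      -(t x w u * covDerivCovec D (dScalar φ) x (h x κ) (h x α)) := by
  rw [riemannMixed, hD.riemann_of_isFlat hST hflat hφ, hST.orthogonal, map_sub, map_smul, map_smul,
    hST.covec_conn_spatialGradient hφ x α (h x κ)]
  simp

lemma RelativeAction.riemannMixedSym_eq_zero [T2Space M]
    (hD : RelativeAction D (geomTensor t h φ) Dg)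
    (hST : IsClassicalSpacetime t h D) (hflat : IsFlat D) (hφ : ContMDiff 𝓘(ℝ, E4) 𝓘(ℝ, ℝ) ∞ φ)
    (x : M) (α κ : Cot x) (u w : Tan x) : riemannMixedSym h Dg x α u κ w = 0 := by
  simp only [riemannMixedSym, hD.riemannMixed_eq hST hflat hφ]
  rw [hessian_symm hST.derivative_operator hφ x (h x κ), hST.t_symm x u w]
  ring

lemma RelativeAction.acceleration_eq (hD : RelativeAction D (geomTensor t h φ) Dg) (γ : ℝ → M)
    (s : ℝ) : acceleration Dg γ s = acceleration D γ s
      + t (γ s) (velocity γ s) (velocity γ s) • spatialGradient h φ (γ s) := by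
  rw [acceleration, acceleration, hD.apply (vecDiffAt_extend _)]
  simp [add_assoc]

lemma RelativeAction.acceleration_eq_zero_iff (hD : RelativeAction D (geomTensor t h φ) Dg)
    {γ : ℝ → M} {s : ℝ} (hs : t (γ s) (velocity γ s) (velocity γ s) = 1) :
    acceleration Dg γ s = 0 ↔ -spatialGradient h φ (γ s) = acceleration D γ s := by
  rw [hD.acceleration_eq, hs, one_smul, neg_eq_iff_add_eq_zero, add_comm]

lemma RelativeAction.geometrizes (hD : RelativeAction D (geomTensor t h φ) Dg)
    (τ : Π x : M, Cot x) : Geometrizes t h τ D φ Dg := fun _ _ hγ ↦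
  forall₂_congr fun s hs ↦ hD.acceleration_eq_zero_iff (hγ.2 s hs).1

/-! ### Acceleration in a moving frame -/

lemma conn_add_apply (D : Conn M) {X Y : Π x : M, Tan x} {x : M} (hX : VecDiffAt X x)
    (hY : VecDiffAt Y x) (v : Tan x) : D (X + Y) x v = D X x v + D Y x v := by
  rw [D.isCovariantDerivativeOnUniv.add hX hY]; rfl

lemma conn_smul_apply (D : Conn M) {X : Π x : M, Tan x} {f : M → ℝ} {x : M} (hX : VecDiffAt X x)
    (hf : MDifferentiableAt 𝓘(ℝ, E4) 𝓘(ℝ, ℝ) f x) (v : Tan x) :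
    D (f • X) x v = f x • D X x v + mvfderiv 𝓘(ℝ, E4) f x v • X x := by
  rw [D.isCovariantDerivativeOnUniv.leibniz hX hf]; rfl

lemma vecDiffAt_sum_smul {ι : Type*} (s : Finset ι) {f : ι → M → ℝ} {X : ι → Π x : M, Tan x}
    {x : M} (hf : ∀ i, MDifferentiableAt 𝓘(ℝ, E4) 𝓘(ℝ, ℝ) (f i) x) (hX : ∀ i, VecDiffAt (X i) x) :
    VecDiffAt (∑ i ∈ s, f i • X i) x := by
  classical
  induction s using Finset.induction_on with
  | empty => rw [Finset.sum_empty]; exact mdifferentiableAt_zeroSection ..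
  | insert a s ha ih =>
    rw [Finset.sum_insert ha]
    exact mdifferentiableAt_add_section (MDifferentiableAt.smul_section (hf a) (hX a)) ih

lemma conn_sum_smul (D : Conn M) {ι : Type*} (s : Finset ι) {f : ι → M → ℝ}
    {X : ι → Π x : M, Tan x} {x : M} (hf : ∀ i, MDifferentiableAt 𝓘(ℝ, E4) 𝓘(ℝ, ℝ) (f i) x)
    (hX : ∀ i, VecDiffAt (X i) x) (v : Tan x) :
    D (∑ i ∈ s, f i • X i) x v =
      ∑ i ∈ s, (f i x • D (X i) x v + mvfderiv 𝓘(ℝ, E4) (f i) x v • X i x) := by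
  classical
  induction s using Finset.induction_on with
  | empty => simp
  | insert a s ha ih =>
    rw [Finset.sum_insert ha, Finset.sum_insert ha,
      conn_add_apply D (MDifferentiableAt.smul_section (hf a) (hX a)) (vecDiffAt_sum_smul s hf hX),
      conn_smul_apply D (hX a) (hf a), ih]

lemma vecDiffAt_chartField {x y : M} (hy : y ∈ (chartAt E4 x).source) (w : E4) :
    VecDiffAt (chartField x w) y :=
  ((contMDiffOn_chartField x w).contMDiffAt
    ((chartAt E4 x).open_source.mem_nhds hy)).mdifferentiableAt (by simp)

lemma chartField_sum {ι : Type*} (s : Finset ι) (x : M) (a : ι → ℝ) (b : ι → E4) {y : M}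
    (hy : y ∈ (extChartAt 𝓘(ℝ, E4) x).source) :
    chartField x (∑ i ∈ s, a i • b i) y = ∑ i ∈ s, a i • chartField x (b i) y := by
  simp only [chartField_eq_mfderiv_symm x _ hy]
  have := map_sum (mfderiv 𝓘(ℝ, E4) 𝓘(ℝ, E4) (extChartAt 𝓘(ℝ, E4) x).symm
    (extChartAt 𝓘(ℝ, E4) x y)) (fun i ↦ a i • b i) s
  refine this.trans ?_
  exact Finset.sum_congr rfl fun i _ ↦ map_smul _ _ _

/-- The standard basis of the model space. -/
abbrev stdVec (i : Fin 4) : E4 := EuclideanSpace.single i 1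

lemma sum_smul_stdVec (w : E4) : ∑ i, w i • stdVec i = w := by
  have := (EuclideanSpace.basisFun (Fin 4) ℝ).sum_repr w
  simpa only [EuclideanSpace.basisFun_repr, EuclideanSpace.basisFun_apply] using this

lemma chartField_eq_sum (x : M) (w : E4) {y : M} (hy : y ∈ (extChartAt 𝓘(ℝ, E4) x).source) :
    chartField x w y = ∑ i, w i • chartField x (stdVec i) y := by
  conv_lhs => rw [← sum_smul_stdVec w]
  exact chartField_sum _ x _ _ hy

lemma conn_sum_chartField (D : Conn M) {ι : Type*} (s : Finset ι) (x : M) (a : ι → ℝ) (b : ι → E4)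
    (v : Tan x) :
    D (chartField x (∑ i ∈ s, a i • b i)) x v = ∑ i ∈ s, a i • D (chartField x (b i)) x v := by
  have hX i : VecDiffAt (chartField x (b i)) x := vecDiffAt_chartField (mem_chart_source E4 x) _
  have hf i : MDifferentiableAt 𝓘(ℝ, E4) 𝓘(ℝ, ℝ) (fun _ : M ↦ a i) x := mdifferentiableAt_const
  have h1 := conn_sum_smul D s hf hX v
  rw [D.isCovariantDerivativeOnUniv.congr_of_eventuallyEq
    (vecDiffAt_chartField (mem_chart_source E4 x) _) (vecDiffAt_sum_smul s hf hX) Filter.univ_mem,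
    h1]
  · refine Finset.sum_congr rfl fun i _ ↦ ?_
    rw [mvfderiv_const, zero_apply, zero_smul, add_zero]
  · filter_upwards [extChartAt_source_mem_nhds (I := 𝓘(ℝ, E4)) x] with y hy
    rw [chartField_sum s x a b hy]
    simp

/-- The components of a vector field in the preferred chart at `x`. -/
def components (x : M) (X : Π y : M, Tan y) (y : M) : E4 :=
  mfderiv 𝓘(ℝ, E4) 𝓘(ℝ, E4) (extChartAt 𝓘(ℝ, E4) x) y (X y)

@[simp] lemma components_self (x : M) (X : Π y : M, Tan y) : components x X x = X x := by
  rw [components, mfderiv_extChartAt_self]; rfl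

lemma components_eventuallyEq {x y : M} (hy : y ∈ (chartAt E4 x).source) (X : Π y : M, Tan y) :
    components x X =ᶠ[𝓝 y]
      fun z ↦ (trivializationAt E4 (fun y : M ↦ TangentSpace 𝓘(ℝ, E4) y) x ⟨z, X z⟩).2 := by
  filter_upwards [(chartAt E4 x).open_source.mem_nhds hy] with z hz
  have := congr($(TangentBundle.continuousLinearMapAt_trivializationAt (I := 𝓘(ℝ, E4)) hz) (X z))
  refine Eq.trans this.symm ?_
  exact congrFun (Trivialization.coe_linearMapAt_of_mem (R := ℝ)
    (trivializationAt E4 (TangentSpace 𝓘(ℝ, E4)) x) hz) (X z)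

lemma mdifferentiableAt_components {x : M} {X : Π y : M, Tan y} (hX : VecDiffAt X x) :
    MDifferentiableAt 𝓘(ℝ, E4) 𝓘(ℝ, E4) (components x X) x := by
  have h1 := (mdifferentiableAt_section 𝓘(ℝ, E4) X).1 hX
  exact h1.congr_of_eventuallyEq (components_eventuallyEq (mem_chart_source E4 x) X)

lemma chartField_components (x : M) (X : Π y : M, Tan y) {y : M}
    (hy : y ∈ (extChartAt 𝓘(ℝ, E4) x).source) : chartField x (components x X y) y = X y :=
  chartField_mfderiv_extChartAt x hy (X y)

lemma mvfderiv_comp_eval (f : M → E4) {x : M} (hf : MDifferentiableAt 𝓘(ℝ, E4) 𝓘(ℝ, E4) f x)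
    (i : Fin 4) (v : Tan x) :
    MDifferentiableAt 𝓘(ℝ, E4) 𝓘(ℝ, ℝ) (fun y ↦ f y i) x ∧
    mvfderiv 𝓘(ℝ, E4) (fun y ↦ f y i) x v = mvfderiv 𝓘(ℝ, E4) f x v i := by
  have h1 := (EuclideanSpace.proj i : E4 →L[ℝ] ℝ).hasFDerivAt (x := f x)
  have h2 := HasMFDerivAt.comp x h1.hasMFDerivAt hf.hasMFDerivAt
  refine ⟨h2.mdifferentiableAt, ?_⟩
  exact congr($(h2.mfderiv) v)

/-- The derivatives of the components of a vector field in the preferred chart. -/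
def dComponents (x : M) (X : Π y : M, Tan y) (v : Tan x) : Tan x :=
  (mvfderiv 𝓘(ℝ, E4) (components x X) x v : E4)

/-- This is `∂X + ΓX`: expand `X` in coordinate fields and apply the Leibniz rule. -/
lemma conn_eq_components (D : Conn M) {x : M} {X : Π y : M, Tan y} (hX : VecDiffAt X x)
    (v : Tan x) :
    D X x v = D (chartField x (X x)) x v + dComponents x X v := by
  have hc := mdifferentiableAt_components hX
  have hf i : MDifferentiableAt 𝓘(ℝ, E4) 𝓘(ℝ, ℝ) (fun y ↦ components x X y i) x :=
    (mvfderiv_comp_eval _ hc i 0).1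
  have hE i : VecDiffAt (chartField x (stdVec i)) x := vecDiffAt_chartField (mem_chart_source E4 x) _
  have h1 := conn_sum_smul D Finset.univ hf hE v
  rw [D.isCovariantDerivativeOnUniv.congr_of_eventuallyEq hX
    (vecDiffAt_sum_smul Finset.univ hf hE) Filter.univ_mem, h1]
  · rw [Finset.sum_add_distrib]
    congr 1
    · have h2 := conn_sum_chartField D Finset.univ x (fun i ↦ components x X x i) stdVec v
      rw [sum_smul_stdVec] at h2
      exact h2.symm.trans
        (congrArg (fun w : E4 ↦ D (chartField x w) x v) (components_self x X))
    · refine Eq.trans ?_ (sum_smul_stdVec _)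
      refine Finset.sum_congr rfl fun i _ ↦ ?_
      rw [(mvfderiv_comp_eval _ hc i v).2, chartField_self]
      rfl
  · filter_upwards [extChartAt_source_mem_nhds (I := 𝓘(ℝ, E4)) x] with y hy
    conv_lhs => rw [← chartField_components x X hy, chartField_eq_sum x _ hy]
    simp

lemma hasDerivAt_comp_curve {F : Type*} [NormedAddCommGroup F] [NormedSpace ℝ F] {f : M → F}
    {γ : ℝ → M} {s : ℝ} (hf : MDifferentiableAt 𝓘(ℝ, E4) 𝓘(ℝ, F) f (γ s))
    (hγ : MDifferentiableAt 𝓘(ℝ, ℝ) 𝓘(ℝ, E4) γ s) :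
    HasDerivAt (fun r ↦ f (γ r)) (mvfderiv 𝓘(ℝ, E4) f (γ s) (velocity γ s)) s := by
  have h1 : HasFDerivAt (fun r ↦ f (γ r))
      ((mvfderiv 𝓘(ℝ, E4) f (γ s)).comp (mfderiv 𝓘(ℝ, ℝ) 𝓘(ℝ, E4) γ s) : ℝ →L[ℝ] F) s :=
    hasMFDerivAt_iff_hasFDerivAt.1 (hf.hasMFDerivAt.comp s hγ.hasMFDerivAt)
  exact h1.hasDerivAt

lemma sum_add_sum_smul {ι V : Type*} [Fintype ι] [AddCommGroup V] [Module ℝ V] (a b : ι → ℝ)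
    (p q r : ι → V) :
    ∑ i, (a i • p i + b i • q i) + ∑ i, a i • r i = ∑ i, (b i • q i + a i • (r i + p i)) := by
  rw [← Finset.sum_add_distrib]
  exact Finset.sum_congr rfl fun i _ ↦ by module

/-- The definition of `acceleration` uses the chart at `γ s`, which changes with `s`. This form
allows one fixed family of fields along the whole curve, so that the geodesic equation can be solved
in a single chart. -/
lemma acceleration_eq_sum (D : Conn M) {ι : Type*} [Fintype ι] {γ : ℝ → M} {s : ℝ}
    (hγ : ∀ᶠ r in 𝓝 s, MDifferentiableAt 𝓘(ℝ, ℝ) 𝓘(ℝ, E4) γ r)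
    {X : ι → Π x : M, Tan x} (hX : ∀ i, VecDiffAt (X i) (γ s)) {c : ι → ℝ → ℝ} {c' : ι → ℝ}
    (hc : ∀ i, HasDerivAt (c i) (c' i) s)
    (hv : ∀ᶠ r in 𝓝 s, velocity γ r = ∑ i, c i r • X i (γ r)) :
    acceleration D γ s = ∑ i, (c' i • X i (γ s) + c i s • D (X i) (γ s) (velocity γ s)) := by
  have hγs := hγ.self_of_nhds
  have h1 : ∀ᶠ r in 𝓝 s, deriv (extChartAt 𝓘(ℝ, E4) (γ s) ∘ γ) r =
      ∑ i, c i r • components (γ s) (X i) (γ r) := by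
    filter_upwards [hγ, hv, hγs.continuousAt.eventually
      ((chartAt E4 (γ s)).open_source.mem_nhds (mem_chart_source E4 (γ s)))] with r hr hvr hsr
    have h2 := (hasDerivAt_comp_curve (mdifferentiableAt_extChartAt hsr) hr).deriv
    refine h2.trans ?_
    rw [hvr]
    refine (map_sum _ _ _).trans ?_
    exact Finset.sum_congr rfl fun i _ ↦ map_smul _ _ _
  have h3 : HasDerivAt (fun r ↦ ∑ i, c i r • components (γ s) (X i) (γ r))
      (∑ i, (c i s • mvfderiv 𝓘(ℝ, E4) (components (γ s) (X i)) (γ s) (velocity γ s) +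
        c' i • components (γ s) (X i) (γ s))) s :=
    HasDerivAt.fun_sum fun i _ ↦ (hc i).smul
      (hasDerivAt_comp_curve (mdifferentiableAt_components (hX i)) hγs)
  have h4 : coordAcceleration γ s = _ := (Filter.EventuallyEq.deriv_eq h1).trans h3.deriv
  have h5 := conn_sum_chartField D Finset.univ (γ s) (fun i ↦ c i s) (fun i ↦ X i (γ s))
    (velocity γ s)
  have h6 : D (FiberBundle.extend E4 (velocity γ s)) (γ s) (velocity γ s) =
      D (chartField (γ s) (∑ i, c i s • X i (γ s))) (γ s) (velocity γ s) :=
    congrArg (fun w : Tan (γ s) ↦ D (FiberBundle.extend E4 w) (γ s) (velocity γ s))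
      hv.self_of_nhds
  rw [acceleration, h4, h6]
  refine (congrArg _ h5).trans ?_
  simp only [components_self, conn_eq_components D (hX _)]
  exact sum_add_sum_smul (V := Tan (γ s)) (fun i ↦ c i s) c'
    (fun i ↦ dComponents (γ s) (X i) (velocity γ s)) (fun i ↦ X i (γ s)) _

/-- A consequence of `∇t = 0`. The velocity lives only on the curve, so compatibility is applied to
the fields `X i` and combined with the product rule for the coefficients. It makes `t(ξ, ξ)`
constant on geodesics. -/
lemma hasDerivAt_t_velocity (hST : IsClassicalSpacetime t h D) {ι : Type*} [Fintype ι] {γ : ℝ → M}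
    {s : ℝ} (hγ : ∀ᶠ r in 𝓝 s, MDifferentiableAt 𝓘(ℝ, ℝ) 𝓘(ℝ, E4) γ r)
    {X : ι → Π x : M, Tan x} (hX : ∀ i, VecDiffAt (X i) (γ s)) {c : ι → ℝ → ℝ} {c' : ι → ℝ}
    (hc : ∀ i, HasDerivAt (c i) (c' i) s)
    (hv : ∀ᶠ r in 𝓝 s, velocity γ r = ∑ i, c i r • X i (γ r)) :
    HasDerivAt (fun r ↦ t (γ r) (velocity γ r) (velocity γ r))
      (2 * t (γ s) (acceleration D γ s) (velocity γ s)) s := by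
  have h1 : (fun r ↦ t (γ r) (velocity γ r) (velocity γ r)) =ᶠ[𝓝 s]
      fun r ↦ ∑ i, ∑ j, c i r * c j r * t (γ r) (X i (γ r)) (X j (γ r)) := by
    filter_upwards [hv] with r hr
    simp only [hr, map_sum, map_smul, sum_apply, smul_apply, smul_eq_mul, Finset.mul_sum]
    rw [Finset.sum_comm]
    exact Finset.sum_congr rfl fun i _ ↦ Finset.sum_congr rfl fun j _ ↦ by ring
  have h2 (i j) : HasDerivAt (fun r ↦ t (γ r) (X i (γ r)) (X j (γ r)))
      (t (γ s) (D (X i) (γ s) (velocity γ s)) (X j (γ s))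
        + t (γ s) (X i (γ s)) (D (X j) (γ s) (velocity γ s))) s := by
    have h3 := hasDerivAt_comp_curve ((hST.t_smooth.apply (hX i)).apply (hX j)) hγ.self_of_nhds
    have h4 := hST.t_compatible _ _ _ (hX i) (hX j) (velocity γ s)
    rw [sub_sub, sub_eq_zero] at h4
    exact h3.congr_deriv h4
  have h5 := HasDerivAt.fun_sum (u := Finset.univ) fun i _ ↦
    HasDerivAt.fun_sum (u := Finset.univ) fun j _ ↦ ((hc i).mul (hc j)).mul (h2 i j)
  refine (h5.congr_of_eventuallyEq h1).congr_deriv ?_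
  have h6 : 2 * t (γ s) (acceleration D γ s) (velocity γ s) =
      t (γ s) (acceleration D γ s) (velocity γ s) + t (γ s) (velocity γ s) (acceleration D γ s) := by
    rw [hST.t_symm _ (velocity γ s), two_mul]
  have hv0 := hv.self_of_nhds
  rw [h6, acceleration_eq_sum D hγ hX hc hv]
  generalize hξ : velocity γ s = ξ at *
  have h7 (f : ι → Tan (γ s)) : t (γ s) (∑ i, f i) ξ + t (γ s) ξ (∑ i, f i) =
      ∑ i, ∑ j, (c j s * t (γ s) (f i) (X j (γ s)) + c i s * t (γ s) (X i (γ s)) (f j)) := by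
    simp only [Finset.sum_add_distrib, map_sum, sum_apply]
    congr 1
    · refine Finset.sum_congr rfl fun i _ ↦ ?_
      conv_lhs => rw [hv0]
      simp
    · rw [Finset.sum_comm]
      refine Finset.sum_congr rfl fun i _ ↦ ?_
      conv_lhs => rw [hv0]
      simp
  rw [h7]
  refine Finset.sum_congr rfl fun i _ ↦ Finset.sum_congr rfl fun j _ ↦ ?_
  simp only [map_add, map_smul, add_apply, smul_apply, smul_eq_mul, Pi.mul_apply]
  ring

/-! ### Existence of geodesics -/

lemma contMDiffAt_components {x y : M} (hy : y ∈ (chartAt E4 x).source) {X : Π x : M, Tan x}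
    (hX : ContMDiffAt 𝓘(ℝ, E4) (𝓘(ℝ, E4).prod 𝓘(ℝ, E4)) ∞
      (fun y ↦ TotalSpace.mk' E4 (E := fun y : M ↦ TangentSpace 𝓘(ℝ, E4) y) y (X y)) y) :
    ContMDiffAt 𝓘(ℝ, E4) 𝓘(ℝ, E4) ∞ (components x X) y := by
  have h1 := ((trivializationAt E4 (fun y : M ↦ TangentSpace 𝓘(ℝ, E4) y) x).contMDiffAt_section_iff
    hy).1 hX
  exact h1.congr_of_eventuallyEq (components_eventuallyEq hy X)

/-- The Christoffel symbols `Γ^a_ij` of `D` in the preferred chart at `x`. -/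
def christoffel (D : Conn M) (x : M) (q : Fin 4 × Fin 4) (p : E4) : E4 :=
  components x (fun y ↦ D (chartField x (stdVec q.1)) y (chartField x (stdVec q.2) y))
    ((extChartAt 𝓘(ℝ, E4) x).symm p)

lemma contDiffOn_christoffel [T2Space M] (hD : D.ContMDiffCovariantDerivative ∞) (x : M)
    (q : Fin 4 × Fin 4) :
    ContDiffOn ℝ ∞ (christoffel D x q) (extChartAt 𝓘(ℝ, E4) x).target := by
  rw [← contMDiffOn_iff_contDiffOn]
  intro p hp
  have hy : (extChartAt 𝓘(ℝ, E4) x).symm p ∈ (chartAt E4 x).source := by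
    rw [← extChartAt_source 𝓘(ℝ, E4)]; exact (extChartAt 𝓘(ℝ, E4) x).map_target hp
  have h1 := ContMDiffAt.clm_bundle_apply (F₁ := E4) (F₂ := E4) (b := fun m ↦ m)
    (contMDiffAt_conn_chartField hD hy (stdVec q.1))
    ((contMDiffOn_chartField x (stdVec q.2)).contMDiffAt
      ((chartAt E4 x).open_source.mem_nhds hy))
  exact (contMDiffAt_components hy h1).comp_contMDiffWithinAt p
    (contMDiffOn_extChartAt_symm x p hp)

/-- The vector field on phase space whose integral curves are the geodesics. -/
def geodesicField (D : Conn M) (x : M) (z : E4 × E4) : E4 × E4 :=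
  (z.2, ∑ q : Fin 4 × Fin 4, (-(z.2 q.1 * z.2 q.2)) • christoffel D x q z.1)

lemma contDiffOn_geodesicField [T2Space M] (hD : D.ContMDiffCovariantDerivative ∞) (x : M) :
    ContDiffOn ℝ ∞ (geodesicField D x) ((extChartAt 𝓘(ℝ, E4) x).target ×ˢ univ) := by
  refine contDiff_snd.contDiffOn.prodMk (ContDiffOn.sum fun q _ ↦ ?_)
  have h1 : ContDiffOn ℝ ∞ (fun z : E4 × E4 ↦ -(z.2 q.1 * z.2 q.2))
      ((extChartAt 𝓘(ℝ, E4) x).target ×ˢ univ) := ContDiff.contDiffOn (by fun_prop)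
  exact h1.smul ((contDiffOn_christoffel hD x q).comp contDiff_fst.contDiffOn fun z hz ↦ hz.1)

/-- Bootstrapping: if `α` is `C^n`, so is its derivative `F ∘ α`, hence `α` is `C^(n+1)`. -/
lemma contDiffOn_of_hasDerivAt {E : Type*} [NormedAddCommGroup E] [NormedSpace ℝ E] {F : E → E}
    {U : Set E} (hF : ContDiffOn ℝ ∞ F U) {α : ℝ → E} {I : Set ℝ} (hI : IsOpen I)
    (hU : MapsTo α I U) (hα : ∀ s ∈ I, HasDerivAt α (F (α s)) s) : ContDiffOn ℝ ∞ α I := by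
  have hd : DifferentiableOn ℝ α I := fun s hs ↦ (hα s hs).differentiableAt.differentiableWithinAt
  rw [contDiffOn_infty]
  intro n
  induction n with
  | zero => exact contDiffOn_zero.2 hd.continuousOn
  | succ n ih =>
    push_cast
    rw [contDiffOn_succ_iff_deriv_of_isOpen hI]
    refine ⟨hd, by simp, ?_⟩
    exact ((hF.of_le (by exact_mod_cast le_top)).comp ih hU).congr fun s hs ↦ (hα s hs).deriv

lemma exists_geodesicField_solution [T2Space M] (hD : D.ContMDiffCovariantDerivative ∞) (x : M)
    (w : E4) : ∃ p v : ℝ → E4, p 0 = extChartAt 𝓘(ℝ, E4) x x ∧ v 0 = w ∧ ∃ ε > (0 : ℝ),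
      ContDiffOn ℝ ∞ p (Ioo (-ε) ε) ∧ ∀ s ∈ Ioo (-ε) ε, p s ∈ (extChartAt 𝓘(ℝ, E4) x).target ∧
        HasDerivAt p (v s) s ∧ HasDerivAt v
          (∑ q : Fin 4 × Fin 4, (-(v s q.1 * v s q.2)) • christoffel D x q (p s)) s := by
  set U := (extChartAt 𝓘(ℝ, E4) x).target ×ˢ (univ : Set E4)
  have hF := contDiffOn_geodesicField hD x
  have hUo : IsOpen U := (isOpen_extChartAt_target x).prod isOpen_univ
  have hx : (extChartAt 𝓘(ℝ, E4) x x, w) ∈ U := ⟨mem_extChartAt_target x, mem_univ _⟩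
  have hF1 : ContDiffOn ℝ 1 (geodesicField D x) U := hF.of_le (by exact_mod_cast le_top)
  obtain ⟨α, hα0, ε, hε, hα⟩ :=
    ((hF.contDiffAt (hUo.mem_nhds hx)).of_le
      (by exact_mod_cast le_top)).exists_forall_mem_closedBall_exists_eq_forall_mem_Ioo_hasDerivAt₀
      0
  simp only [zero_sub, zero_add] at hα
  -- The local solution need not stay over the chart target, where the field is smooth; by
  -- continuity it does after shrinking the interval to `min ε δ`.
  have h1 : ∀ᶠ s in 𝓝 (0 : ℝ), α s ∈ U :=
    (hα 0 ⟨by linarith, hε⟩).continuousAt.eventually (hα0 ▸ hUo.mem_nhds hx)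
  obtain ⟨δ, hδ, h2⟩ := Metric.eventually_nhds_iff.1 h1
  have hsub {s : ℝ} (hs : s ∈ Ioo (-(min ε δ)) (min ε δ)) : s ∈ Ioo (-ε) ε ∧ α s ∈ U := by
    have := min_le_left ε δ
    have := min_le_right ε δ
    refine ⟨⟨by linarith [hs.1], by linarith [hs.2]⟩, h2 ?_⟩
    rw [Real.dist_eq, sub_zero, abs_lt]
    exact ⟨by linarith [hs.1], by linarith [hs.2]⟩
  refine ⟨fun s ↦ (α s).1, fun s ↦ (α s).2, by simp [hα0], by simp [hα0], min ε δ, lt_min hε hδ, ?_,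
    fun s hs ↦ ⟨(hsub hs).2.1, (hα s (hsub hs).1).fst, (hα s (hsub hs).1).snd⟩⟩
  exact contDiff_fst.comp_contDiffOn (contDiffOn_of_hasDerivAt hF isOpen_Ioo
    (fun s hs ↦ (hsub hs).2) fun s hs ↦ hα s (hsub hs).1)

lemma exists_geodesic [T2Space M] (hD : D.ContMDiffCovariantDerivative ∞) (x : M) (w : E4) :
    ∃ (γ : ℝ → M) (v : ℝ → E4), γ 0 = x ∧ v 0 = w ∧ ∃ ε > (0 : ℝ),
      ContMDiffOn 𝓘(ℝ, ℝ) 𝓘(ℝ, E4) ∞ γ (Ioo (-ε) ε) ∧ ∀ s ∈ Ioo (-ε) ε,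
        γ s ∈ (chartAt E4 x).source ∧ DifferentiableAt ℝ v s ∧
        velocity γ s = ∑ i, v s i • chartField x (stdVec i) (γ s) ∧ acceleration D γ s = 0 := by
  obtain ⟨p, v, hp0, hv0, ε, hε, hp, H⟩ := exists_geodesicField_solution hD x w
  set e := extChartAt 𝓘(ℝ, E4) x
  have hγ : ContMDiffOn 𝓘(ℝ, ℝ) 𝓘(ℝ, E4) ∞ (fun s ↦ e.symm (p s)) (Ioo (-ε) ε) :=
    (contMDiffOn_extChartAt_symm x).comp hp.contMDiffOn fun s hs ↦ (H s hs).1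
  have hsrc {s : ℝ} (hs : s ∈ Ioo (-ε) ε) : e.symm (p s) ∈ e.source := e.map_target (H s hs).1
  have hvel : ∀ s ∈ Ioo (-ε) ε, velocity (fun s ↦ e.symm (p s)) s =
      ∑ i, v s i • chartField x (stdVec i) (e.symm (p s)) := by
    intro s hs
    rw [← chartField_eq_sum x (v s) (hsrc hs), chartField_eq_mfderiv_symm x _ (hsrc hs)]
    have h1 := (mdifferentiableAt_extChartAt_symm x (H s hs).1).hasMFDerivAt.comp s
      (H s hs).2.1.hasFDerivAt.hasMFDerivAt
    have h2 := congr($(h1.mfderiv) (1 : ℝ))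
    refine h2.trans ?_
    rw [e.right_inv (H s hs).1]
    refine congrArg (mfderiv 𝓘(ℝ, E4) 𝓘(ℝ, E4) e.symm (p s)) ?_
    exact one_smul ℝ (v s)
  refine ⟨fun s ↦ e.symm (p s), v, ?_, hv0, ε, hε, hγ, fun s hs ↦
    ⟨extChartAt_source 𝓘(ℝ, E4) x ▸ hsrc hs, (H s hs).2.2.differentiableAt, hvel s hs, ?_⟩⟩
  · exact (congrArg e.symm hp0).trans (extChartAt_to_inv x)
  have hnhds : Ioo (-ε) ε ∈ 𝓝 s := isOpen_Ioo.mem_nhds hs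
  have hX i : VecDiffAt (chartField x (stdVec i)) (e.symm (p s)) :=
    vecDiffAt_chartField (extChartAt_source 𝓘(ℝ, E4) x ▸ hsrc hs) _
  have hc i : HasDerivAt (fun s ↦ v s i) _ s :=
    ((EuclideanSpace.proj i : E4 →L[ℝ] ℝ).hasFDerivAt).comp_hasDerivAt s (H s hs).2.2
  have h1 := acceleration_eq_sum D (γ := fun s ↦ e.symm (p s))
    (Filter.eventually_of_mem hnhds fun r hr ↦
      (hγ.contMDiffAt (isOpen_Ioo.mem_nhds hr)).mdifferentiableAt (by simp)) hX hc
    (Filter.eventually_of_mem hnhds hvel)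
  -- The first sum is the derivative of `v`, equal to `-Γvv` by the differential equation; the
  -- second is `Γvv`.
  rw [h1, Finset.sum_add_distrib, hvel s hs]
  have h2 := chartField_eq_sum x
    (∑ q : Fin 4 × Fin 4, (-(v s q.1 * v s q.2)) • christoffel D x q (p s)) (hsrc hs)
  rw [chartField_sum _ _ _ _ (hsrc hs)] at h2
  refine (congrArg₂ (· + ·) h2.symm rfl).trans ?_
  rw [Fintype.sum_prod_type, ← Finset.sum_add_distrib]
  refine Finset.sum_eq_zero fun i _ ↦ ?_
  rw [map_sum, Finset.smul_sum, ← Finset.sum_add_distrib]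
  refine Finset.sum_eq_zero fun j _ ↦ ?_
  rw [christoffel, chartField_components x _ (hsrc hs), map_smul, smul_smul, ← add_smul,
    neg_add_cancel, zero_smul]

/-! ### Timelike geodesics determine a derivative operator -/

lemma ContinuousCovec.continuousAt_apply {τ : Π x : M, Cot x} (hτ : ContinuousCovec τ)
    {X : Π x : M, Tan x} {x : M} (hX : VecDiffAt X x) : ContinuousAt (fun y ↦ τ y (X y)) x := by
  have h1 : ContinuousAt (fun m ↦ TotalSpace.mk' ℝ (E := Bundle.Trivial M ℝ) m (τ m (X m))) x :=
    ContinuousAt.clm_bundle_apply (F₁ := E4) (F₂ := ℝ) (b := fun m ↦ m) hτ.continuousAt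
      (MDifferentiableAt.continuousAt hX)
  rw [FiberBundle.continuousAt_totalSpace] at h1
  exact h1.2

/-- Along a geodesic `t(ξ, ξ)` keeps its initial value 1; positivity of `τ(ξ)` follows near 0 from
continuity. The initial condition is an equality in the tangent bundle because `γ 0 = x` is not
definitional. -/
lemma exists_timelike_geodesic [T2Space M] (hST : IsClassicalSpacetime t h D)
    {τ : Π x : M, Cot x} (hτ : IsTemporalOrientation t τ) {x : M} {ξ : Tan x} (hξ : τ x ξ = 1) :
    ∃ (γ : ℝ → M) (ε : ℝ), 0 < ε ∧
      (⟨γ 0, velocity γ 0⟩ : TangentBundle 𝓘(ℝ, E4) M) = ⟨x, ξ⟩ ∧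
      IsTimelikeCurve t τ γ (Ioo (-ε) ε) ∧ IsGeodesic D γ (Ioo (-ε) ε) := by
  obtain ⟨γ, v, hγ0, hv0, ε, hε, hγ, H⟩ := exists_geodesic hST.derivative_operator.smooth x ξ
  have h0 : (0 : ℝ) ∈ Ioo (-ε) ε := ⟨by linarith, hε⟩
  have hdiff {s : ℝ} (hs : s ∈ Ioo (-ε) ε) : MDifferentiableAt 𝓘(ℝ, ℝ) 𝓘(ℝ, E4) γ s :=
    (hγ.contMDiffAt (isOpen_Ioo.mem_nhds hs)).mdifferentiableAt (by simp)
  have hX {s : ℝ} (hs : s ∈ Ioo (-ε) ε) i : VecDiffAt (chartField x (stdVec i)) (γ s) :=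
    vecDiffAt_chartField (H s hs).1 _
  have hv {s : ℝ} (hs : s ∈ Ioo (-ε) ε) i : DifferentiableAt ℝ (fun s ↦ v s i) s :=
    ((EuclideanSpace.proj i : E4 →L[ℝ] ℝ).differentiableAt).comp s (H s hs).2.1
  have hbase : (⟨γ 0, velocity γ 0⟩ : TangentBundle 𝓘(ℝ, E4) M) = ⟨x, ξ⟩ := by
    have h1 : velocity γ 0 = chartField x (v 0) (γ 0) := by
      rw [(H 0 h0).2.2.1, chartField_eq_sum x (v 0)
        (by rw [extChartAt_source]; exact (H 0 h0).1)]
    rw [h1, hv0]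
    exact (congrArg (fun y : M ↦ (⟨y, chartField x ξ y⟩ : TangentBundle 𝓘(ℝ, E4) M)) hγ0).trans
      (congrArg (fun w : Tan x ↦ (⟨x, w⟩ : TangentBundle 𝓘(ℝ, E4) M)) (chartField_self x ξ))
  have hτ0 : τ (γ 0) (velocity γ 0) = 1 :=
    (congrArg (fun z : TangentBundle 𝓘(ℝ, E4) M ↦ τ z.1 z.2) hbase).trans hξ
  have ht0 : t (γ 0) (velocity γ 0) (velocity γ 0) = 1 := by rw [hτ.2, hτ0, one_mul]
  have hderiv {s : ℝ} (hs : s ∈ Ioo (-ε) ε) :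
      HasDerivAt (fun r ↦ t (γ r) (velocity γ r) (velocity γ r)) 0 s := by
    refine (hasDerivAt_t_velocity hST
      (Filter.eventually_of_mem (isOpen_Ioo.mem_nhds hs) fun r hr ↦ hdiff hr) (hX hs)
      (fun i ↦ (hv hs i).hasDerivAt)
      (Filter.eventually_of_mem (isOpen_Ioo.mem_nhds hs) fun r hr ↦ (H r hr).2.2.1)).congr_deriv ?_
    rw [(H s hs).2.2.2, map_zero, zero_apply, mul_zero]
  have hunit {s : ℝ} (hs : s ∈ Ioo (-ε) ε) : t (γ s) (velocity γ s) (velocity γ s) = 1 :=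
    (isOpen_Ioo.is_const_of_deriv_eq_zero isPreconnected_Ioo
      (fun s hs ↦ (hderiv hs).differentiableAt.differentiableWithinAt)
      (fun s hs ↦ (hderiv hs).deriv) hs h0).trans ht0
  have hcont : ContinuousAt (fun r ↦ τ (γ r) (velocity γ r)) 0 := by
    have h1 : ContinuousAt (fun r ↦ ∑ i, v r i * τ (γ r) (chartField x (stdVec i) (γ r))) 0 :=
      tendsto_finsetSum _ fun i _ ↦ ((hv h0 i).continuousAt).mul
        (ContinuousAt.comp (f := γ) (hτ.1.continuousAt_apply (hX h0 i)) (hdiff h0).continuousAt)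
    refine h1.congr (Filter.eventually_of_mem (isOpen_Ioo.mem_nhds h0) fun r hr ↦ ?_)
    simp only [(H r hr).2.2.1, map_sum, map_smul, smul_eq_mul]
  have hpos : ∀ᶠ r in 𝓝 (0 : ℝ), 0 < τ (γ r) (velocity γ r) :=
    hcont.eventually (lt_mem_nhds (one_pos.trans_eq hτ0.symm))
  obtain ⟨δ, hδ, h2⟩ := Metric.eventually_nhds_iff.1 hpos
  have hsub : Ioo (-(min ε δ)) (min ε δ) ⊆ Ioo (-ε) ε :=
    Ioo_subset_Ioo (neg_le_neg (min_le_left ε δ)) (min_le_left ε δ)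
  have hmin : 0 < min ε δ := lt_min hε hδ
  refine ⟨γ, min ε δ, hmin, hbase, ⟨⟨ordConnected_Ioo, ?_, Ioo (-ε) ε, isOpen_Ioo, ordConnected_Ioo,
    hsub, hγ⟩, fun s hs ↦ ⟨hunit (hsub hs), h2 ?_⟩⟩, fun s hs ↦ (H s (hsub hs)).2.2.2⟩
  · exact ⟨0, ⟨by linarith, hmin⟩, min ε δ / 2, ⟨by linarith, by linarith⟩, by linarith⟩
  · rw [Real.dist_eq, sub_zero, abs_lt]
    exact ⟨by linarith [hs.1, min_le_right ε δ], by linarith [hs.2, min_le_right ε δ]⟩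

/-- A symmetric bilinear map vanishing on the diagonal of an open half-space vanishes. -/
lemma eq_zero_of_diag_eq_zero {V W : Type*} [AddCommGroup V] [Module ℝ V] [AddCommGroup W]
    [Module ℝ W] (B : V → V →ₗ[ℝ] W) (hB : ∀ u v, B u v = B v u) (f : V →ₗ[ℝ] ℝ) {ξ : V}
    (hξ : f ξ = 1) (hdiag : ∀ v, 0 < f v → B v v = 0) (u v : V) : B u v = 0 := by
  have hadd (u v w : V) : B (u + v) w = B u w + B v w := by
    rw [hB, map_add, hB w u, hB w v]
  have hneg (u w : V) : B (-u) w = -B u w := by rw [hB, map_neg, hB w u]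
  have hsq (w : V) : B w w = 0 := by
    -- Long enough that `η`, `η + w` and `η - w` all lie in the half-space. The parallelogram
    -- identity then gives `2 B(w, w) = 0`, and polarization finishes below.
    set η := (|f w| + 1) • ξ
    have hη : f η = |f w| + 1 := by simp [η, hξ]
    have h0 := hdiag η (by rw [hη]; positivity)
    have h1 := hdiag (η + w) (by rw [map_add, hη]; linarith [neg_abs_le (f w)])
    have h2 := hdiag (η + -w) (by rw [map_add, map_neg, hη]; linarith [le_abs_self (f w)])
    simp only [hadd, map_add, hneg, map_neg, h0] at h1 h2
    have h3 : (2 : ℝ) • B w w = 0 := by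
      rw [← add_zero (0 : W), ← congrArg₂ (· + ·) h1 h2]
      module
    simpa using h3
  have h1 := hsq (u + v)
  simp only [hadd, map_add, hsq, hB v u, zero_add, add_zero] at h1
  have h3 : (2 : ℝ) • B u v = 0 := by rw [two_smul, h1]
  simpa using h3

lemma IsDerivativeOperator.conn_chartField_symm (hD : IsDerivativeOperator D) (x : M)
    (u v : Tan x) : D (chartField x u) x v = D (chartField x v) x u := by
  have h1 := hD.torsion_apply (vecDiffAt_extend v) (vecDiffAt_extend u)
  rw [FiberBundle.extend_apply_self, FiberBundle.extend_apply_self] at h1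
  exact sub_eq_zero.1 (h1.trans (mlieBracket_chartField x v u))

lemma IsTemporalOrientation.exists_eq_one {τ : Π x : M, Cot x} (hτ : IsTemporalOrientation t τ)
    {x : M} (hx : IsTemporalAt x (t x)) : ∃ ξ : Tan x, τ x ξ = 1 := by
  obtain ⟨-, b, hb⟩ := hx
  have h1 := hb 0 0
  rw [hτ.2] at h1
  have h2 : τ x (b 0) ≠ 0 := fun h ↦ by simp [h] at h1
  exact ⟨(τ x (b 0))⁻¹ • b 0, by rw [map_smul, smul_eq_mul, inv_mul_cancel₀ h2]⟩

/-- Along a common geodesic the coordinate accelerations cancel, so the difference `B` of the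
operators satisfies `B(ξ, ξ) = 0`. Zero torsion on both sides makes `B` symmetric. -/
lemma sameOperator_of_isGeodesic [T2Space M] (hST : IsClassicalSpacetime t h D)
    {τ : Π x : M, Cot x} (hτ : IsTemporalOrientation t τ) (hD' : IsDerivativeOperator D')
    (hgeo : ∀ (γ : ℝ → M) (J : Set ℝ), IsTimelikeCurve t τ γ J → IsGeodesic D γ J →
      IsGeodesic D' γ J) : SameOperator D' D := by
  intro X x hX
  let B (u : Tan x) : Tan x →ₗ[ℝ] Tan x := (D' (chartField x u) x - D (chartField x u) x :)
  have hB (u v : Tan x) : B u v = D' (chartField x u) x v - D (chartField x u) x v := rfl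
  have hunit (ξ : Tan x) (hξ : τ x ξ = 1) : B ξ ξ = 0 := by
    obtain ⟨γ, ε, hε, hbase, hγ, hg⟩ := exists_timelike_geodesic hST hτ hξ
    have h0 : (0 : ℝ) ∈ Ioo (-ε) ε := ⟨by linarith, hε⟩
    have h1 := hg 0 h0
    have h2 := hgeo γ _ hγ hg 0 h0
    rw [acceleration] at h1 h2
    have h3 : D' (chartField (γ 0) (velocity γ 0)) (γ 0) (velocity γ 0) =
        D (chartField (γ 0) (velocity γ 0)) (γ 0) (velocity γ 0) :=
      add_left_cancel (h2.trans h1.symm)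
    rw [hB, sub_eq_zero]
    -- A predicate on the bundle, so that `hbase` can move the equation from the fibre over `γ 0` to
    -- that over `x`.
    let P (z : TangentBundle 𝓘(ℝ, E4) M) : Prop :=
      D' (chartField z.1 z.2) z.1 z.2 = D (chartField z.1 z.2) z.1 z.2
    exact (congrArg P hbase).mp h3
  have hsymm (u v : Tan x) : B u v = B v u := by
    rw [hB, hB, hD'.conn_chartField_symm, hST.derivative_operator.conn_chartField_symm]
  obtain ⟨ξ, hξ⟩ := hτ.exists_eq_one (hST.t_signature x)
  -- By homogeneity, vectors with `τ w > 0` reduce to those with `τ w = 1`.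
  have hzero := eq_zero_of_diag_eq_zero B hsymm (τ x : Tan x →ₗ[ℝ] ℝ) hξ fun w hw ↦ by
    have hw : τ x w ≠ 0 := ne_of_gt hw
    have h1 := hunit ((τ x w)⁻¹ • w) (by rw [map_smul, smul_eq_mul, inv_mul_cancel₀ hw])
    rw [map_smul, hsymm, map_smul, smul_smul] at h1
    exact (smul_eq_zero.1 h1).resolve_left (by positivity)
  ext1 v
  have h1 := hzero (X x) v
  rw [hB, sub_eq_zero] at h1
  rw [conn_eq_components D' hX, conn_eq_components D hX, h1]

end NewtonCartan

end

theorem mainTheorem1 {M : Type*} [TopologicalSpace M] [T2Space M] [ConnectedSpace M]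
    [ChartedSpace E4 M] [IsManifold 𝓘(ℝ, E4) ∞ M]
    (t : Π x : M, Tan x →L[ℝ] Cot x) (h : Π x : M, Cot x →L[ℝ] Tan x) (D : Conn M)
    (hST : IsClassicalSpacetime t h D) (hflat : IsFlat D)
    (φ ρ : M → ℝ) (hφ : ContMDiff 𝓘(ℝ, E4) 𝓘(ℝ, ℝ) ∞ φ) (hρ : ContMDiff 𝓘(ℝ, E4) 𝓘(ℝ, ℝ) ∞ ρ)
    (hPoisson : ∀ x, laplacian h D φ x = 4 * Real.pi * ρ x) :
    -- there is a derivative operator whose action relative to `D` is given by `- t_bc ∇^a φ`,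
    (∃ Dg : Conn M, IsDerivativeOperator Dg ∧ RelativeAction D (geomTensor t h φ) Dg) ∧
    -- and for every such operator the following hold
    ∀ Dg : Conn M, RelativeAction D (geomTensor t h φ) Dg →
      -- it yields a classical spacetime;
      IsClassicalSpacetime t h Dg ∧
      -- it is the unique derivative operator whose timelike geodesics are the solution curves;
      (∀ τ : Π x : M, Cot x, IsTemporalOrientation t τ →
        Geometrizes t h τ D φ Dg ∧
        (∀ (γ : ℝ → M) (J : Set ℝ), IsTimelikeCurve t τ γ J → ∀ s ∈ J,
          (acceleration Dg γ s = 0 ↔ -spatialGradient h φ (γ s) = acceleration D γ s)) ∧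
        ∀ D' : Conn M, IsDerivativeOperator D' → Geometrizes t h τ D φ D' → SameOperator D' Dg) ∧
      -- its curvature satisfies the geometrized Poisson equation and the two integrability conditions
      (∀ (x : M) (u v : Tan x), ricci Dg x u v = 4 * Real.pi * ρ x * t x u v) ∧
      (∀ (x : M) (α β : Cot x) (v w : Tan x), riemannUpUp h Dg x α β v w = 0) ∧
      (∀ (x : M) (α κ : Cot x) (u w : Tan x), riemannMixedSym h Dg x α u κ w = 0) := by
  refine ⟨⟨geometrization t h D φ, ?_, relativeAction_geometrization hST⟩, fun Dg hDg ↦ ?_⟩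
  · exact (relativeAction_geometrization hST).isDerivativeOperator hST hφ
  have hSTg : IsClassicalSpacetime t h Dg := hDg.isClassicalSpacetime hST hφ
  refine ⟨hSTg, fun τ hτ ↦ ⟨hDg.geometrizes τ, fun γ J hγ s hs ↦
    hDg.acceleration_eq_zero_iff (hγ.2 s hs).1, fun D' hD' hgeo ↦ ?_⟩, fun x u v ↦ ?_,
    hDg.riemannUpUp_eq_zero hST hflat hφ, hDg.riemannMixedSym_eq_zero hST hflat hφ⟩
  -- The base operator here is `Dg`, not `D`: its timelike geodesics solve the equation of motion,
  -- hence are geodesics of `D'`.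
  · exact sameOperator_of_isGeodesic hSTg hτ hD' fun γ J hγ hg ↦
      (hgeo γ J hγ).2 ((hDg.geometrizes τ γ J hγ).1 hg)
  · rw [hDg.ricci_eq hST hflat hφ, hPoisson]
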